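/- Let $A$ be a finite alphabet. A onesided subshift $\Sigma\subset A^{\mathbb N}$ (a closed set with $\sigma(\Sigma)\subset\Sigma$, $\sigma$ the shift) is \emph{sofic} if the language of its finite factors is regular, equivalently if $\Sigma$ is the set of labels of infinite paths in some finite edge-labeled graph (a \emph{graph of} $\Sigma$). A twosided subshift $\Gamma\subset A^{\mathbb Z}$ is an \emph{SFT} if it is defined by finitely many forbidden words; a graph of $\Gamma$ is a finite edge-labeled graph whose biinfinite paths have exactly the elements of $\Gamma$ as labels. A cellular automaton of anchor $m\in\mathbb Z$, diameter $d>0$ and local rule $f:A^d\to A$ has global map $F(x)_i=f(x_{i-m},\dots,x_{i-m+d-1})$ on $A^{\mathbb Z}$. The subshift $\Sigma$ is \emph{partially traceable} if there are a cellular automaton $F$ on $A$ and a twosided SFT $\Gamma\subset A^{\mathbb Z}$ with $F(\Gamma)\subset\Gamma$ and $$\{(F^j(x)_0)_{j\in\mathbb N} : x\in\Gamma\}=\Sigma .$$ Every uncountable sofic subshift $\Sigma\subset A^{\mathbb N}$ is partially traceable, effectively from $\Sigma$: there is one algorithm which, given the size of $A$ (whose letters are numbered) and any finite representation of an uncountable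 sofic subshift $\Sigma\subset A^{\mathbb N}$, namely a graph of $\Sigma$ or a finite automaton recognizing the language of $\Sigma$, halts and outputs a cellular automaton $F$ on $A$ (anchor, diameter and table of the local rule) and a graph of a twosided SFT $\Gamma\subset A^{\mathbb Z}$ such that $F(\Gamma)\subset\Gamma$ and $\{(F^j(x)_0)_{j\in\mathbb N} : x\in\Gamma\}=\Sigma$. -/

import Mathlib

open SymbolicDynamics.FullShift

namespace SoficTrace

/-- The word `w` is a factor of the sequence `x`, indexed by `G = ℕ` (infinite word) or `G = ℤ`
(configuration). -/
def IsFactor {A G : Type*} [AddMonoidWithOne G] (w : List A) (x : G → A) : Prop :=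
  ∃ i : G, ∀ (j : ℕ) (hj : j < w.length), x (i + (j : G)) = w[j]

/-- The language of a set of infinite words: all their finite factors. -/
def factorLanguage {A : Type*} (X : Set (ℕ → A)) : Language A :=
  {w : List A | ∃ z ∈ X, IsFactor w z}

/-- A onesided subshift is sofic if its language is regular. -/
def IsSofic {A : Type*} [TopologicalSpace A] (S : Subshift A ℕ) : Prop :=
  (factorLanguage S.carrier).IsRegular

/-- A twosided subshift is of finite type if it is defined by finitely many forbidden words. -/
def IsSFT {A : Type*} [TopologicalSpace A] (Γ : Subshift A ℤ) : Prop :=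
  ∃ W : Set (List A), W.Finite ∧ Γ.carrier = {x : ℤ → A | ∀ w ∈ W, ¬ IsFactor w x}

/-- A one-dimensional cellular automaton on the alphabet `A`. -/
structure CellularAutomaton (A : Type*) where
  anchor : ℤ
  diameter : ℕ
  diameter_pos : 0 < diameter
  rule : (Fin diameter → A) → A

/-- The global function `F(x)_i = f(x_{i-m}, …, x_{i-m+d-1})`. -/
def CellularAutomaton.globalMap {A : Type*} (F : CellularAutomaton A) (x : ℤ → A) : ℤ → A :=
  fun i => F.rule fun j => x (i - F.anchor + (j : ℕ))

/-- The set of infinite words `(F^j(x)_0)_j`, for `x` in `X`. -/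
def CellularAutomaton.traceOn {A : Type*} (F : CellularAutomaton A) (X : Set (ℤ → A)) :
    Set (ℕ → A) :=
  {z | ∃ x ∈ X, ∀ j : ℕ, z j = (F.globalMap^[j] x) 0}

/-- `F` restricts to a partial cellular automaton `Γ → Γ` on the SFT `Γ`, with trace `S`. -/
def PartiallyTraces {A : Type*} [TopologicalSpace A] (F : CellularAutomaton A)
    (Γ : Subshift A ℤ) (S : Subshift A ℕ) : Prop :=
  IsSFT Γ ∧ Set.MapsTo F.globalMap Γ.carrier Γ.carrier ∧ F.traceOn Γ.carrier = S.carrier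

def IsPartiallyTraceable {A : Type*} [TopologicalSpace A] (S : Subshift A ℕ) : Prop :=
  ∃ (F : CellularAutomaton A) (Γ : Subshift A ℤ), PartiallyTraces F Γ S

/-! ### Finite representations

A finite alphabet is represented by `n : ℕ` and a numbering `e : A ≃ Fin n` of its letters. -/

/-- A finite edge-labeled graph: the list of its edges `(source, label, target)`. -/
abbrev GraphCode : Type := List (ℕ × ℕ × ℕ)

/-- The labels of the edges are (numbers of) letters of an alphabet with `n` letters. -/
def GraphCode.WellFormed (E : GraphCode) (n : ℕ) : Prop :=
  ∀ q ∈ E, q.2.1 < n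

/-- `E` is a graph of the set `X` of infinite words (`G = ℕ`) or of configurations (`G = ℤ`):
`X` is the set of labels of the infinite, respectively biinfinite, paths in `E`. -/
def IsGraphOf {A G : Type*} [AddMonoidWithOne G] {n : ℕ} (e : A ≃ Fin n) (E : GraphCode)
    (X : Set (G → A)) : Prop :=
  E.WellFormed n ∧
    X = {x : G → A | ∃ v : G → ℕ, ∀ i : G, (v i, (e (x i) : ℕ), v (i + 1)) ∈ E}

/-- A finite automaton: its edges, its initial states and its accepting states. -/
abbrev AutomatonCode : Type := GraphCode × List ℕ × List ℕ

/-- The automaton represented by a code. -/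
def AutomatonCode.toNFA {A : Type*} {n : ℕ} (e : A ≃ Fin n) (M : AutomatonCode) : NFA A ℕ where
  step s a := {t : ℕ | (s, (e a : ℕ), t) ∈ M.1}
  start := {s : ℕ | s ∈ M.2.1}
  accept := {s : ℕ | s ∈ M.2.2}

/-- A representation of a sofic subshift: one of its graphs, or a finite automaton that recognizes
its language. -/
abbrev SoficCode : Type := GraphCode ⊕ AutomatonCode

def SoficCode.Represents {A : Type*} [TopologicalSpace A] {n : ℕ} (e : A ≃ Fin n)
    (S : Subshift A ℕ) : SoficCode → Prop
  | Sum.inl E => IsGraphOf e E S.carrier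
  | Sum.inr M => M.1.WellFormed n ∧ (M.toNFA e).accepts = factorLanguage S.carrier

/-- A cellular automaton: its anchor, its diameter and the table of its local rule. -/
abbrev CACode : Type := ℤ × ℕ × List (List ℕ × ℕ)

/-- The code has the anchor and the diameter of `F`, and its table is the graph of the local rule. -/
def CACode.Represents {A : Type*} {n : ℕ} (e : A ≃ Fin n) (C : CACode)
    (F : CellularAutomaton A) : Prop :=
  C.1 = F.anchor ∧ C.2.1 = F.diameter ∧
    ∀ (l : List ℕ) (b : ℕ), (l, b) ∈ C.2.2 ↔
      ∃ w : Fin F.diameter → A, l = List.ofFn (fun j => (e (w j) : ℕ)) ∧ b = (e (F.rule w) : ℕ)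

end SoficTrace

/-! Let `E` be a finite graph without dead ends whose infinite path labels form `Σ`. If no vertex
carried two cycles of equal length with different labels, every label would be a finite word
followed by a tail determined by a recurrent vertex, so `Σ` would be countable. Hence uncountability
provides two cycles at one vertex, with labels `u ≠ v` of length `L` (`nonempty_twoCycles`). They
are the only freedom available for storing information, because the history of every cell must
itself be a word of `Σ`.

Configurations are concatenations of tiles of one length, all at the same time `t` modulo `4L`. A
tile holds a state, namely an active and a stored path of length `4L` in `E`, and has four zones.
The marker and the separator read the periodic word `uuuv`, in long runs and letter by letter
respectively. Each bit of the state occupies a data block of `L` cells, through which the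
corresponding cycle label slides to the left. The last cell displays the current letter of the
active path. After `4L` steps the stored path becomes active, if it connects, and the stored path of
the right neighbour is copied. A row of tiles storing successive segments of any given path thus
displays that whole path in one cell (`IsSupply.exists_evolution`).

For the converse inclusion, every cell of every tile receives a set of possible vertices, compatible
with the evolution. Paths are followed backwards through these sets and extended forwards, so each
finite history is a prefix of a label, and closedness of `Σ` suffices
(`IsVertexLabelling.exists_mem_labels`). Sets are needed because a data cell may show the common
prefix of `u` and `v` before the next bit is known.

Primitivity of `uuuv` makes `t` readable, and the runs prevent a tile from occurring at an
intermediate offset of two adjacent ones (`TwoCycles.offset_eq_zero`). The tiling is therefore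
locally recognizable: it defines an SFT, and the tile rules define a local rule.

Effectiveness comes from a search. All the requirements on the tiles, the vertex sets and the pruned
graph are primitive recursive conditions on a finite certificate. Any certificate gives a correct
output (`Certifies.exists_partiallyTraces`), and the construction above shows that one exists
(`exists_certifies`). -/

namespace SoficTrace

/-! ### Automation for primitive recursive functions and predicates -/

section PrimrecAutomation

-- Every condition on certificates quantifies only over lists and initial segments of `ℕ`, so these
-- closure rules let `fun_prop` prove its primitive recursiveness.
attribute [fun_prop] Primrec PrimrecPred Primrec.id Primrec.const Primrec.comp Primrec.pair
  PrimrecPred.comp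

variable {α β γ σ : Type*} [Primcodable α] [Primcodable β] [Primcodable γ] [Primcodable σ]

@[fun_prop]
theorem primrec_fst_comp {f : α → β × γ} (hf : Primrec f) : Primrec fun a => (f a).1 :=
  Primrec.fst.comp hf

@[fun_prop]
theorem primrec_snd_comp {f : α → β × γ} (hf : Primrec f) : Primrec fun a => (f a).2 :=
  Primrec.snd.comp hf

@[fun_prop]
theorem primrecPred_forall_mem {f : α → List β} {p : α → β → Prop} (hf : Primrec f)
    (hp : PrimrecPred fun x : α × β => p x.1 x.2) : PrimrecPred fun a => ∀ x ∈ f a, p a x := by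
  have h : PrimrecRel fun (b : β) (a : α) => p a b :=
    hp.comp (Primrec.pair Primrec.snd Primrec.fst)
  exact h.forall_mem_list.comp hf Primrec.id

@[fun_prop]
theorem primrecPred_exists_mem {f : α → List β} {p : α → β → Prop} (hf : Primrec f)
    (hp : PrimrecPred fun x : α × β => p x.1 x.2) : PrimrecPred fun a => ∃ x ∈ f a, p a x := by
  have h : PrimrecRel fun (b : β) (a : α) => p a b :=
    hp.comp (Primrec.pair Primrec.snd Primrec.fst)
  exact h.exists_mem_list.comp hf Primrec.id

@[fun_prop]
theorem primrecPred_forall_lt {f : α → ℕ} {p : α → ℕ → Prop} (hf : Primrec f)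
    (hp : PrimrecPred fun x : α × ℕ => p x.1 x.2) : PrimrecPred fun a => ∀ i < f a, p a i := by
  have : PrimrecPred fun a => ∀ i ∈ List.range (f a), p a i :=
    primrecPred_forall_mem (Primrec.list_range.comp hf) hp
  simpa using this

@[fun_prop]
theorem primrecPred_eq {f g : α → β} (hf : Primrec f) (hg : Primrec g) :
    PrimrecPred fun a => f a = g a :=
  PrimrecRel.comp Primrec.eq hf hg

@[fun_prop]
theorem primrecPred_lt {f g : α → ℕ} (hf : Primrec f) (hg : Primrec g) :
    PrimrecPred fun a => f a < g a :=
  Primrec.nat_lt.comp hf hg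

@[fun_prop]
theorem primrecPred_mem {f : α → β} {g : α → List β} (hf : Primrec f) (hg : Primrec g) :
    PrimrecPred fun a => f a ∈ g a := by
  have : PrimrecPred fun a => ∃ x ∈ g a, x = f a := by fun_prop
  simpa using this

@[fun_prop]
theorem primrecPred_and {p q : α → Prop} (hp : PrimrecPred p) (hq : PrimrecPred q) :
    PrimrecPred fun a => p a ∧ q a :=
  hp.and hq

@[fun_prop]
theorem primrecPred_or {p q : α → Prop} (hp : PrimrecPred p) (hq : PrimrecPred q) :
    PrimrecPred fun a => p a ∨ q a :=
  hp.or hq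

@[fun_prop]
theorem primrecPred_imp {p q : α → Prop} (hp : PrimrecPred p) (hq : PrimrecPred q) :
    PrimrecPred fun a => p a → q a :=
  (hp.not.or hq).of_eq fun a => by tauto

@[fun_prop]
theorem primrecPred_ne {f g : α → β} (hf : Primrec f) (hg : Primrec g) :
    PrimrecPred fun a => f a ≠ g a :=
  (primrecPred_eq hf hg).not

@[fun_prop]
theorem primrec_append {f g : α → List β} (hf : Primrec f) (hg : Primrec g) :
    Primrec fun a => f a ++ g a :=
  Primrec.list_append.comp hf hg

@[fun_prop]
theorem primrec_cons {f : α → β} {g : α → List β} (hf : Primrec f) (hg : Primrec g) :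
    Primrec fun a => f a :: g a :=
  Primrec.list_cons.comp hf hg

@[fun_prop]
theorem primrec_length {f : α → List β} (hf : Primrec f) : Primrec fun a => (f a).length :=
  Primrec.list_length.comp hf

@[fun_prop]
theorem primrec_drop {f : α → ℕ} {g : α → List β} (hf : Primrec f) (hg : Primrec g) :
    Primrec fun a => (g a).drop (f a) :=
  Primrec.list_drop.comp hf hg

@[fun_prop]
theorem primrec_take {f : α → ℕ} {g : α → List β} (hf : Primrec f) (hg : Primrec g) :
    Primrec fun a => (g a).take (f a) :=
  Primrec.list_take.comp hf hg

@[fun_prop]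
theorem primrec_reverse {f : α → List β} (hf : Primrec f) : Primrec fun a => (f a).reverse :=
  Primrec.list_reverse.comp hf

@[fun_prop]
theorem primrec_headI [Inhabited β] {f : α → List β} (hf : Primrec f) :
    Primrec fun a => (f a).headI :=
  Primrec.list_headI.comp hf

@[fun_prop]
theorem primrec_getD {f : α → List β} {g : α → ℕ} {d : β} (hf : Primrec f) (hg : Primrec g) :
    Primrec fun a => (f a).getD (g a) d :=
  (Primrec.list_getD d).comp hf hg

@[fun_prop]
theorem primrec_map {f : α → List β} {g : α → β → σ} (hf : Primrec f)
    (hg : Primrec fun x : α × β => g x.1 x.2) : Primrec fun a => (f a).map (g a) :=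
  Primrec.list_map hf hg

@[fun_prop]
theorem primrec_flatMap {f : α → List β} {g : α → β → List σ} (hf : Primrec f)
    (hg : Primrec fun x : α × β => g x.1 x.2) : Primrec fun a => (f a).flatMap (g a) :=
  Primrec.list_flatMap hf hg

@[fun_prop]
theorem primrec_range {f : α → ℕ} (hf : Primrec f) : Primrec fun a => List.range (f a) :=
  Primrec.list_range.comp hf

@[fun_prop]
theorem primrec_add {f g : α → ℕ} (hf : Primrec f) (hg : Primrec g) :
    Primrec fun a => f a + g a :=
  Primrec.nat_add.comp hf hg

@[fun_prop]
theorem primrec_sub {f g : α → ℕ} (hf : Primrec f) (hg : Primrec g) :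
    Primrec fun a => f a - g a :=
  Primrec.nat_sub.comp hf hg

@[fun_prop]
theorem primrec_mul {f g : α → ℕ} (hf : Primrec f) (hg : Primrec g) :
    Primrec fun a => f a * g a :=
  Primrec.nat_mul.comp hf hg

@[fun_prop]
theorem primrec_encode {f : α → β} (hf : Primrec f) : Primrec fun a => Encodable.encode (f a) :=
  Primrec.encode.comp hf

@[fun_prop]
theorem primrec_ite {p : α → Prop} [DecidablePred p] {f g : α → σ} (hp : PrimrecPred p)
    (hf : Primrec f) (hg : Primrec g) : Primrec fun a => if p a then f a else g a :=
  Primrec.ite hp hf hg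

@[fun_prop]
theorem primrec_sumElim {f : α → β ⊕ γ} {g : β → σ} {h : γ → σ} (hf : Primrec f)
    (hg : Primrec g) (hh : Primrec h) : Primrec fun a => Sum.elim g h (f a) :=
  (Primrec.sumCasesOn hf (hg.comp Primrec.snd).to₂ (hh.comp Primrec.snd).to₂).of_eq
    fun a => by cases f a <;> rfl

end PrimrecAutomation

/-! ### Tile systems -/

/-- A finite word over the (numbers of) letters. -/
abbrev Word : Type := List ℕ

/-- A list of triples `(a, b, c)`: the tile `a`, followed on its right by the tile `b`, evolves
into the tile `c`. -/
abbrev TileRules : Type := List (Word × Word × Word)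

/-- The conditions under which the concatenations of tiles form an SFT on which the tile rules
define a cellular automaton: tiles have length `P` and letters below `n`, the rules preserve
adjacency and are deterministic, and a tile does not occur inside two adjacent tiles except at the
beginning or at the end. -/
def IsTileSystem (n P : ℕ) (N : TileRules) : Prop :=
  0 < P ∧
  (∀ τ ∈ N, τ.1.length = P ∧ τ.2.1.length = P ∧ τ.2.2.length = P ∧
    (∀ a ∈ τ.1, a < n) ∧ ∀ a ∈ τ.2.2, a < n) ∧
  (∀ τ ∈ N, ∀ τ' ∈ N, τ.2.1 = τ'.1 → ∃ τ'' ∈ N, τ''.1 = τ.2.2 ∧ τ''.2.1 = τ'.2.2) ∧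
  (∀ τ ∈ N, ∀ τ' ∈ N, τ.1 = τ'.1 → τ.2.1 = τ'.2.1 → τ.2.2 = τ'.2.2) ∧
  ∀ τ ∈ N, ∀ τ' ∈ N, ∀ j < P, ((τ.1 ++ τ.2.1).drop j).take P = τ'.1 → j = 0

/-- `Λ` assigns to the cell `i` of the tile `a` finite sets of vertices of `E`, in such a way that
along the evolution of the tiles every vertex is reached from a previous one by an edge carrying the
letter of the cell. -/
def IsVertexLabelling (P : ℕ) (N : TileRules) (E : GraphCode) (Λ : List (Word × ℕ × List ℕ)) :
    Prop :=
  ∀ τ ∈ N, ∀ i < P, (∃ x ∈ Λ, x.1 = τ.1 ∧ x.2.1 = i) ∧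
    ∀ x ∈ Λ, x.1 = τ.1 → x.2.1 = i → x.2.2 ≠ [] ∧
      ∃ y ∈ Λ, y.1 = τ.2.2 ∧ y.2.1 = i ∧
        ∀ q' ∈ y.2.2, ∃ q ∈ x.2.2, (q, τ.1.getD i 0, q') ∈ E

/-- The target of the last edge of `α` is the source of the first edge of `β`. -/
def Connects (α β : List (ℕ × ℕ × ℕ)) : Prop :=
  α.reverse.headI.2.2 = β.headI.1

/-- `Q` contains all paths of length at most `ℓ` in `E`. -/
def ContainsPaths (E : GraphCode) (ℓ : ℕ) (Q : List (List (ℕ × ℕ × ℕ))) : Prop :=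
  [] ∈ Q ∧ ∀ β ∈ Q, β.length < ℓ → ∀ q ∈ E, (β = [] ∨ q.2.2 = β.headI.1) → q :: β ∈ Q

/-- An element `(t, τ, α, β)` of `K` says that at time `t` modulo `ℓ` the tile `τ` displays the path
`α` of length `ℓ` in its cell `f` and stores the path `β`. These paths have to be passed on as
described. -/
def IsSupply (E : GraphCode) (ℓ f : ℕ) (N : TileRules) (Q : List (List (ℕ × ℕ × ℕ)))
    (K : List (ℕ × Word × List (ℕ × ℕ × ℕ) × List (ℕ × ℕ × ℕ))) : Prop :=
  0 < ℓ ∧ ContainsPaths E ℓ Q ∧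
  (∀ α ∈ Q, ∀ β ∈ Q, α.length = ℓ → β.length = ℓ → ∃ x ∈ K, x.1 = 0 ∧ x.2.2 = (α, β)) ∧
  (∀ x ∈ K, ∀ y ∈ K, x.1 = y.1 → ∃ τ ∈ N, τ.1 = x.2.1 ∧ τ.2.1 = y.2.1 ∧
    ((x.1 + 1 < ℓ ∧ (x.1 + 1, τ.2.2, x.2.2) ∈ K) ∨
      (x.1 + 1 = ℓ ∧ ∃ z ∈ K, z.1 = 0 ∧ z.2.1 = τ.2.2 ∧ z.2.2.2 = y.2.2.2 ∧
        (Connects x.2.2.1 x.2.2.2 → z.2.2.1 = x.2.2.2)))) ∧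
  ∀ x ∈ K, x.2.1.getD f 0 = (x.2.2.1.getD x.1 default).2.1

/-! ### Normal forms of representations -/

/-- The edges of a representation. -/
def SoficCode.edges (D : SoficCode) : GraphCode :=
  Sum.elim (fun E => E) (fun M => M.1) D

/-- The initial vertices of a representation: all sources of edges in the case of a graph. -/
def SoficCode.starts (D : SoficCode) : List ℕ :=
  Sum.elim (fun E : GraphCode => E.map fun q => q.1) (fun M : AutomatonCode => M.2.1) D

/-- The final vertices of a representation: all targets of edges in the case of a graph. -/
def SoficCode.finals (D : SoficCode) : List ℕ :=
  Sum.elim (fun E : GraphCode => E.map fun q => q.2.2) (fun M : AutomatonCode => M.2.2) D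

/-- The graph with all edges reversed. -/
def GraphCode.reversed (E : GraphCode) : GraphCode :=
  E.map fun q => (q.2.2, q.2.1, q.1)

/-- `R` lists the vertices that can be reached from `S` in `E`, with ranks that witness this. -/
def IsReachableList (E : GraphCode) (S : List ℕ) (R : List (ℕ × ℕ)) : Prop :=
  (∀ ρ ∈ R, ρ.1 ∈ S ∨ ∃ ρ' ∈ R, ρ'.2 < ρ.2 ∧ ∃ q ∈ E, q.1 = ρ'.1 ∧ q.2.2 = ρ.1) ∧
  (∀ s ∈ S, ∃ ρ ∈ R, ρ.1 = s) ∧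
  ∀ q ∈ E, ∀ ρ ∈ R, q.1 = ρ.1 → ∃ ρ' ∈ R, ρ'.1 = q.2.2

/-- The source of `q` is listed in `R`, and its target in `C`. -/
def InCore (R C : List (ℕ × ℕ)) (q : ℕ × ℕ × ℕ) : Prop :=
  (∃ ρ ∈ R, ρ.1 = q.1) ∧ ∃ γ ∈ C, γ.1 = q.2.2

/-- `E` consists of the edges of `D` that are accessible, coaccessible and do not lead to a
dead end; `R`, `C` and `Z` list the accessible and the coaccessible vertices and the dead ends. -/
def IsNormalForm (D : SoficCode) (R C Z : List (ℕ × ℕ)) (E : GraphCode) : Prop :=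
  IsReachableList D.edges D.starts R ∧
  IsReachableList D.edges.reversed D.finals C ∧
  (∀ δ ∈ Z, ∀ q ∈ D.edges, InCore R C q → q.1 = δ.1 → ∃ δ' ∈ Z, δ'.1 = q.2.2 ∧ δ'.2 < δ.2) ∧
  (∀ q ∈ E, q ∈ D.edges ∧ InCore R C q ∧ ∃ q' ∈ E, q'.1 = q.2.2) ∧
  ∀ q ∈ D.edges, InCore R C q → q ∈ E ∨ ∃ δ ∈ Z, δ.1 = q.2.2

/-! ### The output -/

/-- All words of length `d` over `n` letters. -/
def allWords (n d : ℕ) : List Word :=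
  Nat.rec [[]] (fun _ W => W.flatMap fun w => (List.range n).map fun a => a :: w) d

/-- The local rule defined by tile rules: find two adjacent tiles around the cell. -/
def tileRule (P : ℕ) (N : TileRules) (w : Word) : ℕ :=
  ((N.flatMap fun τ : Word × Word × Word => (List.range P).flatMap fun j =>
    if (w.drop j).take (2 * P) = τ.1 ++ τ.2.1 then [τ.2.2.getD (P - 1 - j) 0] else []) ++ [0]).headI

/-- The cellular automaton defined by tile rules. -/
def tileCACode (n P : ℕ) (N : TileRules) : CACode :=
  (((P - 1 : ℕ) : ℤ), 3 * P - 1, (allWords n (3 * P - 1)).map fun w => (w, tileRule P N w))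

/-- The vertex of the graph of a tile system that stands before the cell `i` of the tile `a`. -/
def tileVertex (a : Word) (i : ℕ) : ℕ :=
  Encodable.encode (a, i)

/-- The graph of the SFT defined by a tile system. -/
def tileGraph (P : ℕ) (N : TileRules) : GraphCode :=
  N.flatMap fun τ : Word × Word × Word => (List.range P).map fun i =>
    (tileVertex τ.1 i, τ.1.getD i 0,
      if i + 1 < P then tileVertex τ.1 (i + 1) else tileVertex τ.2.1 0)

/-! ### Certificates -/

/-- A certificate: the tile length, the tile rules, the normal form of the given representation with
its witnesses, the vertex labelling and the supply of paths. -/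
abbrev Certificate : Type :=
  (ℕ × TileRules) × (List (ℕ × ℕ) × List (ℕ × ℕ) × List (ℕ × ℕ) × GraphCode) ×
    List (Word × ℕ × List ℕ) ×
    ℕ × List (List (ℕ × ℕ × ℕ)) × List (ℕ × Word × List (ℕ × ℕ × ℕ) × List (ℕ × ℕ × ℕ))

/-- The conditions that a certificate has to satisfy. -/
def Certifies (n : ℕ) (D : SoficCode) (c : Certificate) : Prop :=
  0 < n ∧ IsTileSystem n c.1.1 c.1.2 ∧
  IsNormalForm D c.2.1.1 c.2.1.2.1 c.2.1.2.2.1 c.2.1.2.2.2 ∧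
  IsVertexLabelling c.1.1 c.1.2 c.2.1.2.2.2 c.2.2.1 ∧
  IsSupply c.2.1.2.2.2 c.2.2.2.1 (c.1.1 - 1) c.1.2 c.2.2.2.2.1 c.2.2.2.2.2

/-! ### Primitive recursiveness of the certificate check and of the output -/

section PrimrecChecks

variable {α : Type*} [Primcodable α]

@[fun_prop]
theorem primrecPred_isTileSystem {n P : α → ℕ} {N : α → TileRules} (hn : Primrec n)
    (hP : Primrec P) (hN : Primrec N) : PrimrecPred fun a => IsTileSystem (n a) (P a) (N a) := by
  unfold IsTileSystem
  fun_prop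

@[fun_prop]
theorem primrecPred_isVertexLabelling {P : α → ℕ} {N : α → TileRules} {E : α → GraphCode}
    {Λ : α → List (Word × ℕ × List ℕ)} (hP : Primrec P) (hN : Primrec N) (hE : Primrec E)
    (hΛ : Primrec Λ) : PrimrecPred fun a => IsVertexLabelling (P a) (N a) (E a) (Λ a) := by
  unfold IsVertexLabelling
  fun_prop

@[fun_prop]
theorem primrecPred_connects {β γ : α → List (ℕ × ℕ × ℕ)} (hβ : Primrec β) (hγ : Primrec γ) :
    PrimrecPred fun a => Connects (β a) (γ a) := by
  unfold Connects
  fun_prop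

@[fun_prop]
theorem primrecPred_containsPaths {E : α → GraphCode} {ℓ : α → ℕ}
    {Q : α → List (List (ℕ × ℕ × ℕ))} (hE : Primrec E) (hℓ : Primrec ℓ) (hQ : Primrec Q) :
    PrimrecPred fun a => ContainsPaths (E a) (ℓ a) (Q a) := by
  unfold ContainsPaths
  fun_prop

@[fun_prop]
theorem primrecPred_isSupply {E : α → GraphCode} {ℓ f : α → ℕ} {N : α → TileRules}
    {Q : α → List (List (ℕ × ℕ × ℕ))}
    {K : α → List (ℕ × Word × List (ℕ × ℕ × ℕ) × List (ℕ × ℕ × ℕ))}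
    (hE : Primrec E) (hℓ : Primrec ℓ) (hf : Primrec f) (hN : Primrec N) (hQ : Primrec Q)
    (hK : Primrec K) : PrimrecPred fun a => IsSupply (E a) (ℓ a) (f a) (N a) (Q a) (K a) := by
  unfold IsSupply
  fun_prop

@[fun_prop]
theorem primrec_edges {D : α → SoficCode} (hD : Primrec D) : Primrec fun a => (D a).edges := by
  unfold SoficCode.edges
  fun_prop

@[fun_prop]
theorem primrec_starts {D : α → SoficCode} (hD : Primrec D) : Primrec fun a => (D a).starts := by
  unfold SoficCode.starts
  fun_prop

@[fun_prop]
theorem primrec_finals {D : α → SoficCode} (hD : Primrec D) : Primrec fun a => (D a).finals := by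
  unfold SoficCode.finals
  fun_prop

@[fun_prop]
theorem primrec_reversed {E : α → GraphCode} (hE : Primrec E) :
    Primrec fun a => (E a).reversed := by
  unfold GraphCode.reversed
  fun_prop

@[fun_prop]
theorem primrecPred_isReachableList {E : α → GraphCode} {S : α → List ℕ} {R : α → List (ℕ × ℕ)}
    (hE : Primrec E) (hS : Primrec S) (hR : Primrec R) :
    PrimrecPred fun a => IsReachableList (E a) (S a) (R a) := by
  unfold IsReachableList
  fun_prop

@[fun_prop]
theorem primrecPred_inCore {R C : α → List (ℕ × ℕ)} {q : α → ℕ × ℕ × ℕ} (hR : Primrec R)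
    (hC : Primrec C) (hq : Primrec q) : PrimrecPred fun a => InCore (R a) (C a) (q a) := by
  unfold InCore
  fun_prop

@[fun_prop]
theorem primrecPred_isNormalForm {D : α → SoficCode} {R C Z : α → List (ℕ × ℕ)}
    {E : α → GraphCode} (hD : Primrec D) (hR : Primrec R) (hC : Primrec C) (hZ : Primrec Z)
    (hE : Primrec E) : PrimrecPred fun a => IsNormalForm (D a) (R a) (C a) (Z a) (E a) := by
  unfold IsNormalForm
  fun_prop

theorem primrecPred_certifies :
    PrimrecPred fun x : (ℕ × SoficCode) × Certificate => Certifies x.1.1 x.1.2 x.2 := by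
  unfold Certifies
  fun_prop

@[fun_prop]
theorem primrec_allWords {n d : α → ℕ} (hn : Primrec n) (hd : Primrec d) :
    Primrec fun a => allWords (n a) (d a) := by
  unfold allWords
  refine Primrec.nat_rec' (g := fun _ : α => ([[]] : List Word))
    (h := fun a (p : ℕ × List Word) => p.2.flatMap fun w => (List.range (n a)).map fun b => b :: w)
    hd (Primrec.const _) ?_
  unfold Primrec₂
  fun_prop

@[fun_prop]
theorem primrec_tileRule {P : α → ℕ} {N : α → TileRules} {w : α → Word} (hP : Primrec P)
    (hN : Primrec N) (hw : Primrec w) : Primrec fun a => tileRule (P a) (N a) (w a) := by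
  unfold tileRule
  fun_prop

/-- The encoding of `ℤ` sends a nonnegative `k` to `2 * k`. -/
theorem primrec_natCast_int : Primrec fun k : ℕ => (k : ℤ) := by
  have h : Primrec fun k : ℕ => 2 * k := by fun_prop
  exact Primrec.encode_iff.1 (h.of_eq fun k => show 2 * k = Encodable.encode (k : ℤ) from rfl)

@[fun_prop]
theorem primrec_tileCACode {n P : α → ℕ} {N : α → TileRules} (hn : Primrec n) (hP : Primrec P)
    (hN : Primrec N) : Primrec fun a => tileCACode (n a) (P a) (N a) := by
  unfold tileCACode
  refine Primrec.pair (primrec_natCast_int.comp (by fun_prop)) ?_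
  fun_prop

@[fun_prop]
theorem primrec_tileGraph {P : α → ℕ} {N : α → TileRules} (hP : Primrec P) (hN : Primrec N) :
    Primrec fun a => tileGraph (P a) (N a) := by
  unfold tileGraph tileVertex
  fun_prop

end PrimrecChecks

open Classical in
/-- Search for a certificate and output the cellular automaton and the graph it describes. -/
noncomputable def searchAlgorithm (x : ℕ × SoficCode) : Part (CACode × GraphCode) :=
  Nat.rfindOpt fun k => (Encodable.decode (α := Certificate) k).bind fun c =>
    if Certifies x.1 x.2 c then some (tileCACode x.1 c.1.1 c.1.2, tileGraph c.1.1 c.1.2) else none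

theorem partrec_searchAlgorithm : Partrec searchAlgorithm := by
  classical
  refine Partrec.rfindOpt (Primrec.to_comp ?_)
  refine Primrec.option_bind (Primrec.decode.comp Primrec.snd) ?_
  refine Primrec.ite (c := fun y : ((ℕ × SoficCode) × ℕ) × Certificate =>
    Certifies y.1.1.1 y.1.1.2 y.2) ?_ (Primrec.option_some.comp ?_) (Primrec.const _)
  · exact primrecPred_certifies.comp
      (Primrec.pair (Primrec.fst.comp Primrec.fst) Primrec.snd)
  · fun_prop

/-- The search may stop at a certificate other than `c`, so soundness is needed for arbitrary
certificates and not just for the constructed one. -/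
theorem exists_mem_searchAlgorithm {n : ℕ} {D : SoficCode} {c : Certificate}
    (hc : Certifies n D c) :
    ∃ c', Certifies n D c' ∧
      (tileCACode n c'.1.1 c'.1.2, tileGraph c'.1.1 c'.1.2) ∈ searchAlgorithm (n, D) := by
  classical
  have hdom : (searchAlgorithm (n, D)).Dom := by
    refine Nat.rfindOpt_dom.2 ⟨Encodable.encode c,
      (tileCACode n c.1.1 c.1.2, tileGraph c.1.1 c.1.2), ?_⟩
    rw [Encodable.encodek, Option.bind_some, if_pos hc]
    rfl
  obtain ⟨out, hout⟩ := Part.dom_iff_mem.1 hdom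
  obtain ⟨k, hk⟩ := Nat.rfindOpt_spec hout
  rw [Option.mem_def, Option.bind_eq_some_iff] at hk
  obtain ⟨c', -, hc'⟩ := hk
  split_ifs at hc' with h
  refine ⟨c', h, ?_⟩
  rw [← Option.some.inj hc'] at hout
  exact hout

/-! ### From tile systems to cellular automata on SFTs -/

section WordAt

/-- The word of length `m` at position `i` of `y`. -/
def wordAt (y : ℤ → ℕ) (i : ℤ) (m : ℕ) : Word :=
  (List.range m).map fun o => y (i + (o : ℕ))

@[simp]
theorem length_wordAt (y : ℤ → ℕ) (i : ℤ) (m : ℕ) : (wordAt y i m).length = m := by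
  simp [wordAt]

@[simp]
theorem getElem_wordAt (y : ℤ → ℕ) (i : ℤ) (m o : ℕ) (h : o < (wordAt y i m).length) :
    (wordAt y i m)[o] = y (i + o) := by
  simp [wordAt]

theorem getD_wordAt (y : ℤ → ℕ) (i : ℤ) {m o : ℕ} (h : o < m) :
    (wordAt y i m).getD o 0 = y (i + o) := by
  rw [List.getD_eq_getElem _ _ (by simpa using h), getElem_wordAt]

theorem wordAt_add (y : ℤ → ℕ) (i : ℤ) (m l : ℕ) :
    wordAt y i (m + l) = wordAt y i m ++ wordAt y (i + m) l := by
  simp [wordAt, List.range_add, add_assoc]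

theorem take_drop_wordAt (y : ℤ → ℕ) (i : ℤ) {j l m : ℕ} (h : j + l ≤ m) :
    ((wordAt y i m).drop j).take l = wordAt y (i + j) l := by
  apply List.ext_getElem
  · simp
    omega
  · intro o h₁ h₂
    simp [add_assoc]

theorem eq_wordAt {y : ℤ → ℕ} {i : ℤ} {m : ℕ} {w : Word} (hl : w.length = m)
    (h : ∀ o < m, w.getD o 0 = y (i + o)) : wordAt y i m = w := by
  apply List.ext_getElem
  · simp [hl]
  · intro o h₁ h₂
    rw [getElem_wordAt, ← h o (by simpa using h₁), List.getD_eq_getElem _ _ h₂]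

end WordAt

/-! ### Local recognition of the tiling -/

section Rows

/-- A tile and its right neighbour occur at position `i`. -/
def PairAt (P : ℕ) (N : TileRules) (y : ℤ → ℕ) (i : ℤ) : Prop :=
  ∃ c, (wordAt y i P, wordAt y (i + P) P, c) ∈ N

variable {n P : ℕ} {N : TileRules}

theorem IsTileSystem.offset_eq_zero (h : IsTileSystem n P N) {y : ℤ → ℕ} {i : ℤ} {j : ℕ}
    (hi : PairAt P N y i) (hj : j < P) (hij : PairAt P N y (i + j)) : j = 0 := by
  obtain ⟨-, -, -, -, h⟩ := h
  obtain ⟨c, hc⟩ := hi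
  obtain ⟨c', hc'⟩ := hij
  refine h _ hc _ hc' j hj ?_
  rw [← wordAt_add, take_drop_wordAt _ _ (by omega)]

/-- Some pair starts among the `P` cells after `i`. Starting strictly inside the pair at `i` is
excluded, which leaves only `i + P`. -/
theorem IsTileSystem.pairAt_add (h : IsTileSystem n P N) {y : ℤ → ℕ}
    (hy : ∀ i, ∃ j < P, PairAt P N y (i + (j : ℕ))) {i : ℤ} (hi : PairAt P N y i) :
    PairAt P N y (i + P) := by
  obtain ⟨j, hj, hij⟩ := hy (i + 1)
  have hij' : PairAt P N y (i + ((j + 1 : ℕ) : ℤ)) := by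
    convert hij using 1
    push_cast
    ring
  rcases Nat.lt_or_ge (j + 1) P with hlt | hge
  · have := h.offset_eq_zero hi hlt hij'
    omega
  · obtain rfl : P = j + 1 := by omega
    exact hij'

theorem IsTileSystem.pairAt_sub (h : IsTileSystem n P N) {y : ℤ → ℕ}
    (hy : ∀ i, ∃ j < P, PairAt P N y (i + (j : ℕ))) {i : ℤ} (hi : PairAt P N y i) :
    PairAt P N y (i - P) := by
  obtain ⟨j, hj, hij⟩ := hy (i - P)
  rcases Nat.eq_zero_or_pos j with rfl | hpos
  · simpa using hij
  · have := h.offset_eq_zero (j := P - j) hij (by omega) (by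
      convert hi using 1
      push_cast [hj.le]
      ring)
    omega

/-- The right side only inspects windows of `3 * P - 1` cells. The global phase `r` is thereby
replaced by a local condition, as an SFT requires. -/
theorem IsTileSystem.exists_forall_pairAt_iff (h : IsTileSystem n P N) (y : ℤ → ℕ) :
    (∃ r : ℤ, ∀ k : ℤ, PairAt P N y (r + k * P)) ↔
      ∀ i : ℤ, ∃ j < P, PairAt P N y (i + (j : ℕ)) := by
  have hP : (0 : ℤ) < P := by exact_mod_cast h.1
  constructor
  · rintro ⟨r, hr⟩ i
    refine ⟨((r - i) % P).toNat, ?_, ?_⟩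
    · have := Int.emod_lt_of_pos (r - i) hP
      have := Int.emod_nonneg (r - i) hP.ne'
      omega
    · convert hr (-((r - i) / P)) using 1
      rw [Int.toNat_of_nonneg (Int.emod_nonneg _ hP.ne')]
      have := Int.emod_add_mul_ediv (r - i) P
      linarith
  · intro hy
    obtain ⟨j, -, hj⟩ := hy 0
    refine ⟨0 + j, fun k => ?_⟩
    induction k using Int.induction_on with
    | zero => simpa using hj
    | succ k ih =>
      convert h.pairAt_add hy ih using 1
      ring
    | pred k ih =>
      convert h.pairAt_sub hy ih using 1
      ring

theorem headI_append_of_forall_eq {l : List ℕ} {a b : ℕ} (ha : a ∈ l) (h : ∀ x ∈ l, x = a) :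
    (l ++ [b]).headI = a := by
  cases l with
  | nil => simp at ha
  | cons c l => exact h c (by simp)

/-- Only one of the `P` offsets in the window can start a pair, and the rules are deterministic. All
matches therefore propose the same letter, and the choice of the first one by `headI` is harmless.
-/
theorem IsTileSystem.tileRule_eq (h : IsTileSystem n P N) {y : ℤ → ℕ} {i : ℤ} {c : Word}
    (hc : (wordAt y i P, wordAt y (i + P) P, c) ∈ N) {o : ℕ} (ho : o < P) :
    tileRule P N (wordAt y (i + o - ((P - 1 : ℕ) : ℤ)) (3 * P - 1)) = c.getD o 0 := by
  have hP := h.1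
  have key : ∀ j < P, ((wordAt y (i + o - ((P - 1 : ℕ) : ℤ)) (3 * P - 1)).drop j).take (2 * P) =
      wordAt y (i + o - ((P - 1 : ℕ) : ℤ) + j) P ++
        wordAt y (i + o - ((P - 1 : ℕ) : ℤ) + j + P) P := by
    intro j hj
    rw [take_drop_wordAt _ _ (by omega), two_mul, wordAt_add]
  unfold tileRule
  apply headI_append_of_forall_eq
  · simp only [List.mem_flatMap, List.mem_range]
    -- The window starts `P - 1` cells before the cell `i + o`, so the pair at `i` has offset `P - 1
    -- - o` in it.
    refine ⟨_, hc, P - 1 - o, by omega, ?_⟩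
    have hpos : i + o - ((P - 1 : ℕ) : ℤ) + ((P - 1 - o : ℕ) : ℤ) = i := by omega
    rw [key _ (by omega), hpos, if_pos rfl, List.mem_singleton]
    congr 1
    omega
  · intro x hx
    simp only [List.mem_flatMap, List.mem_range] at hx
    obtain ⟨τ, hτ, j, hj, hx⟩ := hx
    rw [key j hj] at hx
    split_ifs at hx with heq
    · obtain ⟨-, hlen, -, hdet, -⟩ := id h
      obtain ⟨h₁, h₂⟩ := List.append_inj heq (by simp [(hlen τ hτ).1])
      have hpair : PairAt P N y (i + o - ((P - 1 : ℕ) : ℤ) + j) := ⟨τ.2.2, by rw [h₁, h₂]; exact hτ⟩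
      have hj' : j = P - 1 - o := by
        rcases le_total (P - 1 - o) j with hle | hle
        · have := h.offset_eq_zero (j := j - (P - 1 - o)) ⟨c, hc⟩ (by omega) (by
            convert hpair using 1
            omega)
          omega
        · have := h.offset_eq_zero (j := (P - 1 - o) - j) hpair (by omega) (by
            have hpos : i + o - ((P - 1 : ℕ) : ℤ) + j + ((P - 1 - o - j : ℕ) : ℤ) = i := by omega
            rw [hpos]
            exact ⟨c, hc⟩)
          omega
      subst hj'
      have hpos : i + o - ((P - 1 : ℕ) : ℤ) + ((P - 1 - o : ℕ) : ℤ) = i := by omega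
      have hpos' : P - 1 - (P - 1 - o) = o := by omega
      rw [hpos] at h₁ h₂
      rw [List.mem_singleton] at hx
      rw [hx, ← hdet _ hc τ hτ h₁ h₂, hpos']
    · simp at hx

theorem tileRule_lt (h : IsTileSystem n P N) (hn : 0 < n) (w : Word) : tileRule P N w < n := by
  obtain ⟨-, hlen, -⟩ := h
  unfold tileRule
  set l := N.flatMap fun τ : Word × Word × Word => (List.range P).flatMap fun j =>
    if (w.drop j).take (2 * P) = τ.1 ++ τ.2.1 then [τ.2.2.getD (P - 1 - j) 0] else [] with hl
  have hall : ∀ x ∈ l, x < n := by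
    intro x hx
    simp only [hl, List.mem_flatMap, List.mem_range] at hx
    obtain ⟨τ, hτ, j, -, hx⟩ := hx
    split_ifs at hx
    · rw [List.mem_singleton] at hx
      subst hx
      rcases Nat.lt_or_ge (P - 1 - j) τ.2.2.length with hlt | hge
      · rw [List.getD_eq_getElem _ _ hlt]
        exact (hlen τ hτ).2.2.2.2 _ (List.getElem_mem _)
      · rw [List.getD_eq_default _ _ hge]
        exact hn
    · simp at hx
  clear_value l
  cases l with
  | nil => exact hn
  | cons a l => exact hall a List.mem_cons_self

end Rows

/-! ### The cellular automaton and its space-time diagrams -/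

section Automaton

variable {A : Type*} {n P : ℕ} {N : TileRules}

/-- The row of the numbers of the letters of a configuration. -/
def coded {G : Type*} (e : A ≃ Fin n) (x : G → A) : G → ℕ :=
  fun i => e (x i)

theorem coded_injective {G : Type*} (e : A ≃ Fin n) :
    Function.Injective (coded e : (G → A) → G → ℕ) := by
  intro x x' h
  funext i
  exact e.injective (Fin.ext (congrFun h i))

/-- The configuration of the letters with given numbers. -/
def uncoded {G : Type*} (e : A ≃ Fin n) (y : G → ℕ) (hy : ∀ i, y i < n) : G → A :=
  fun i => e.symm ⟨y i, hy i⟩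

@[simp]
theorem coded_uncoded {G : Type*} (e : A ≃ Fin n) (y : G → ℕ) (hy : ∀ i, y i < n) :
    coded e (uncoded e y hy) = y := by
  funext i
  simp [coded, uncoded]

/-- The cellular automaton of a tile system. -/
def tileCA (e : A ≃ Fin n) (h : IsTileSystem n P N) (hn : 0 < n) : CellularAutomaton A where
  anchor := ((P - 1 : ℕ) : ℤ)
  diameter := 3 * P - 1
  diameter_pos := by have := h.1; omega
  rule w := e.symm ⟨tileRule P N (List.ofFn fun j => (e (w j) : ℕ)), tileRule_lt h hn _⟩

theorem mem_allWords {n d : ℕ} {w : Word} :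
    w ∈ allWords n d ↔ w.length = d ∧ ∀ a ∈ w, a < n := by
  induction d generalizing w with
  | zero =>
    have : allWords n 0 = [[]] := rfl
    rw [this, List.mem_singleton, List.length_eq_zero_iff]
    constructor
    · rintro rfl
      simp
    · exact fun h => h.1
  | succ d ih =>
    have : allWords n (d + 1) =
      (allWords n d).flatMap fun w => (List.range n).map fun a => a :: w := rfl
    rw [this]
    simp only [List.mem_flatMap, List.mem_map, List.mem_range, ih]
    constructor
    · rintro ⟨v, ⟨hv, hvn⟩, a, ha, rfl⟩
      exact ⟨by simp [hv], by simpa using ⟨ha, hvn⟩⟩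
    · rintro ⟨hl, hw⟩
      cases w with
      | nil => simp at hl
      | cons a w =>
        simp only [List.mem_cons, forall_eq_or_imp] at hw
        exact ⟨w, ⟨by simpa using hl, hw.2⟩, a, hw.1, rfl⟩

theorem tileCACode_represents (e : A ≃ Fin n) (h : IsTileSystem n P N) (hn : 0 < n) :
    (tileCACode n P N).Represents e (tileCA e h hn) := by
  refine ⟨rfl, rfl, fun l b => ?_⟩
  simp only [tileCACode, List.mem_map, mem_allWords, Prod.mk.injEq]
  constructor
  · rintro ⟨w, ⟨hl, hw⟩, rfl, rfl⟩
    have hv : ∀ j : Fin (3 * P - 1), w.getD j 0 < n := by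
      intro j
      rw [List.getD_eq_getElem _ _ (by rw [hl]; exact j.2)]
      exact hw _ (List.getElem_mem _)
    have hofFn : w = List.ofFn fun j : Fin (3 * P - 1) => (e (e.symm ⟨w.getD j 0, hv j⟩) : ℕ) := by
      apply List.ext_getElem
      · simp [hl]
      · intro o h₁ h₂
        simp [h₁]
    refine ⟨fun j => e.symm ⟨w.getD j 0, hv j⟩, hofFn, ?_⟩
    simp only [tileCA, Equiv.apply_symm_apply]
    congr 1
    simpa using hofFn
  · rintro ⟨w, rfl, rfl⟩
    refine ⟨_, ⟨List.length_ofFn, ?_⟩, rfl, ?_⟩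
    · intro a ha
      obtain ⟨j, rfl⟩ := (List.mem_ofFn' _ _).1 ha
      exact (e (w j)).2
    · simp [tileCA]

theorem coded_tileCA_globalMap (e : A ≃ Fin n) (h : IsTileSystem n P N) (hn : 0 < n)
    (x : ℤ → A) (i : ℤ) :
    coded e ((tileCA e h hn).globalMap x) i =
      tileRule P N (wordAt (coded e x) (i - ((P - 1 : ℕ) : ℤ)) (3 * P - 1)) := by
  simp only [coded, CellularAutomaton.globalMap, tileCA, Equiv.apply_symm_apply]
  congr 1
  apply List.ext_getElem
  · simp
  · intro o h₁ h₂
    simp [coded]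

theorem wordAt_tileCA_globalMap (e : A ≃ Fin n) (h : IsTileSystem n P N) (hn : 0 < n)
    {x : ℤ → A} {i : ℤ} {c : Word}
    (hc : (wordAt (coded e x) i P, wordAt (coded e x) (i + P) P, c) ∈ N) :
    wordAt (coded e ((tileCA e h hn).globalMap x)) i P = c := by
  have hlen := (h.2.1 _ hc).2.2.1
  refine eq_wordAt hlen fun o ho => ?_
  rw [coded_tileCA_globalMap, h.tileRule_eq hc ho]

theorem forall_pairAt_globalMap (e : A ≃ Fin n) (h : IsTileSystem n P N) (hn : 0 < n)
    {x : ℤ → A} {r : ℤ} (hr : ∀ k : ℤ, PairAt P N (coded e x) (r + k * P)) (k : ℤ) :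
    PairAt P N (coded e ((tileCA e h hn).globalMap x)) (r + k * P) := by
  obtain ⟨c, hc⟩ := hr k
  obtain ⟨c', hc'⟩ := hr (k + 1)
  have hpos : r + (k + 1) * P = r + k * P + P := by ring
  rw [hpos] at hc'
  obtain ⟨τ, hτ, h₁, h₂⟩ := h.2.2.1 _ hc _ hc' rfl
  refine ⟨τ.2.2, ?_⟩
  rw [wordAt_tileCA_globalMap e h hn hc, wordAt_tileCA_globalMap e h hn hc']
  simp only at h₁ h₂
  rw [← h₁, ← h₂]
  exact hτ

theorem forall_pairAt_iterate (e : A ≃ Fin n) (h : IsTileSystem n P N) (hn : 0 < n)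
    {x : ℤ → A} {r : ℤ} (hr : ∀ k : ℤ, PairAt P N (coded e x) (r + k * P)) (s : ℕ) (k : ℤ) :
    PairAt P N (coded e ((tileCA e h hn).globalMap^[s] x)) (r + k * P) := by
  induction s generalizing k with
  | zero => exact hr k
  | succ s ih =>
    rw [Function.iterate_succ_apply']
    exact forall_pairAt_globalMap e h hn ih k

/-- A space-time diagram of tiles. -/
def IsEvolution (N : TileRules) (T : ℕ → ℤ → Word) : Prop :=
  ∀ s k, (T s k, T s (k + 1), T (s + 1) k) ∈ N

/-- Cutting a configuration at its phase gives a row of tiles, and gluing reverses this. The cell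
`0` may be any cell `i` of its tile, so all cells of a tile contribute to the trace. -/
theorem mem_traceOn_tileCA_iff (e : A ≃ Fin n) (h : IsTileSystem n P N) (hn : 0 < n)
    (z : ℕ → A) :
    z ∈ (tileCA e h hn).traceOn
        {x | ∃ r : ℤ, ∀ k : ℤ, PairAt P N (coded e x) (r + k * P)} ↔
      ∃ T, IsEvolution N T ∧ ∃ i < P, ∀ s, (T s 0).getD i 0 = e (z s) := by
  have hP : (0 : ℤ) < P := by exact_mod_cast h.1
  constructor
  · rintro ⟨x, ⟨r, hr⟩, hz⟩
    have hall := forall_pairAt_iterate e h hn hr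
    -- Tiles are renumbered so that tile `0` contains the cell `0`, at position `-r % P`.
    refine ⟨fun s k => wordAt (coded e ((tileCA e h hn).globalMap^[s] x))
      (r + (k + -r / P) * P) P, ?_, (-r % P).toNat, ?_, ?_⟩
    · intro s k
      obtain ⟨c, hc⟩ := hall s (k + -r / P)
      have hpos : r + (k + 1 + -r / P) * P = r + (k + -r / P) * P + P := by ring
      simp only [Function.iterate_succ_apply']
      rw [wordAt_tileCA_globalMap e h hn hc, hpos]
      exact hc
    · have := Int.emod_lt_of_pos (-r) hP
      have := Int.emod_nonneg (-r) hP.ne'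
      omega
    · intro s
      have h₁ := Int.emod_lt_of_pos (-r) hP
      have h₂ := Int.emod_nonneg (-r) hP.ne'
      have h₃ := Int.emod_add_mul_ediv (-r) P
      rw [getD_wordAt _ _ (by omega), hz s, coded, Int.toNat_of_nonneg h₂]
      have hpos : r + (((0 : ℤ) + -r / P) * P) + -r % P = 0 := by linarith
      rw [hpos]
  · rintro ⟨T, hT, i, hi, hz⟩
    have hlen : ∀ s k, (T s k).length = P := fun s k => (h.2.1 _ (hT s k)).1
    have hlt : ∀ p : ℤ, (T 0 ((p + i) / P)).getD ((p + i) % P).toNat 0 < n := by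
      intro p
      have h₁ := Int.emod_lt_of_pos (p + i) hP
      have h₂ := Int.emod_nonneg (p + i) hP.ne'
      rw [List.getD_eq_getElem _ _ (by rw [hlen]; omega)]
      exact (h.2.1 _ (hT 0 _)).2.2.2.1 _ (List.getElem_mem _)
    have key : ∀ s (k : ℤ), wordAt (coded e ((tileCA e h hn).globalMap^[s]
        (uncoded e _ hlt))) (-i + k * P) P = T s k := by
      intro s
      induction s with
      | zero =>
        intro k
        refine eq_wordAt (hlen 0 k) fun o ho => ?_
        have h₁ : (-i + k * P + o + i : ℤ) = o + k * P := by ring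
        simp only [Function.iterate_zero, id, coded_uncoded]
        rw [h₁, Int.add_mul_ediv_right _ _ hP.ne', Int.add_mul_emod_self_right,
          Int.ediv_eq_zero_of_lt (by omega) (by omega), Int.emod_eq_of_lt (by omega) (by omega)]
        simp
      | succ s ih =>
        intro k
        rw [Function.iterate_succ_apply']
        have hpos : (-i + k * P + P : ℤ) = -i + (k + 1) * P := by ring
        apply wordAt_tileCA_globalMap
        rw [hpos, ih, ih]
        exact hT s k
    -- Tile `0` starts at `-i`, which puts its cell `i` at the origin.
    refine ⟨uncoded e _ hlt, ⟨-i, fun k => ⟨T 1 k, ?_⟩⟩, fun s => ?_⟩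
    · have hpos : (-i + k * P + P : ℤ) = -i + (k + 1) * P := by ring
      have h₀ := key 0
      simp only [Function.iterate_zero, id] at h₀
      rw [hpos, h₀, h₀]
      exact hT 0 k
    · apply e.injective
      apply Fin.ext
      have hpos : (-i + 0 * P + i : ℤ) = 0 := by ring
      rw [← hz s, ← key s 0, getD_wordAt _ _ hi, coded, hpos]

end Automaton

/-! ### The SFT of a tile system -/

section Subshift

variable {A : Type*} [TopologicalSpace A] [DiscreteTopology A] {n P : ℕ} {N : TileRules}

theorem isClosed_forbidden (W : Set (List A)) :
    IsClosed {x : ℤ → A | ∀ w ∈ W, ¬ IsFactor w x} := by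
  have : {x : ℤ → A | ∀ w ∈ W, ¬ IsFactor w x} =
      ⋂ w ∈ W, ⋂ i : ℤ, ({x | ∀ j : Fin w.length, x (i + (j : ℕ)) = w[j]})ᶜ := by
    ext x
    simp only [IsFactor, Set.mem_ofPred_eq, Set.mem_iInter, Set.mem_compl_iff]
    constructor
    · intro h w hw i hi
      exact h w hw ⟨i, fun j hj => hi ⟨j, hj⟩⟩
    · rintro h w hw ⟨i, hi⟩
      exact h w hw i fun j => hi j j.2
  rw [this]
  refine isClosed_biInter fun w _ => isClosed_iInter fun i => IsOpen.isClosed_compl ?_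
  have : {x : ℤ → A | ∀ j : Fin w.length, x (i + (j : ℕ)) = w[j]} =
      ⋂ j : Fin w.length, (fun x : ℤ → A => x (i + (j : ℕ))) ⁻¹' {w[j]} := by
    ext x
    simp
  rw [this]
  exact isOpen_iInter_of_finite fun j =>
    (isOpen_discrete _).preimage (continuous_apply _)

/-- The subshift defined by a set of forbidden words. -/
def forbiddenSubshift (W : Set (List A)) : Subshift A ℤ where
  carrier := {x | ∀ w ∈ W, ¬ IsFactor w x}
  isClosed := isClosed_forbidden W
  mapsTo := by
    rintro g x hx w hw ⟨i, hi⟩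
    refine hx w hw ⟨g + i, fun j hj => ?_⟩
    rw [add_assoc]
    exact hi j hj

theorem exists_isSFT_tileSystem [Finite A] (e : A ≃ Fin n) (h : IsTileSystem n P N) :
    ∃ Γ : Subshift A ℤ, IsSFT Γ ∧
      Γ.carrier = {x | ∃ r : ℤ, ∀ k : ℤ, PairAt P N (coded e x) (r + k * P)} := by
  have hP := h.1
  -- Length `3 * P - 1` is exactly what a pair of length `2 * P` needs in order to fit at each of
  -- the offsets below `P`.
  let W : Set (List A) := {w | w.length = 3 * P - 1 ∧ ∀ j < P, ∀ τ ∈ N,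
    (((w.map fun a => (e a : ℕ)).drop j).take (2 * P)) ≠ τ.1 ++ τ.2.1}
  refine ⟨forbiddenSubshift W, ⟨W, ?_, rfl⟩, ?_⟩
  · exact (List.finite_length_eq A (3 * P - 1)).subset fun w hw => hw.1
  · ext x
    rw [Set.mem_ofPred_eq, h.exists_forall_pairAt_iff]
    have key : ∀ (i : ℤ), ∀ j < P,
        ((((List.range (3 * P - 1)).map fun o : ℕ => x (i + o)).map
          fun a => (e a : ℕ)).drop j).take (2 * P) =
        wordAt (coded e x) (i + j) P ++ wordAt (coded e x) (i + j + P) P := by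
      intro i j hj
      rw [← wordAt_add, ← two_mul, ← take_drop_wordAt (coded e x) i (m := 3 * P - 1) (by omega),
        List.map_map]
      rfl
    constructor
    · intro hx i
      by_contra hcon
      push Not at hcon
      refine hx ((List.range (3 * P - 1)).map fun o : ℕ => x (i + o)) ⟨by simp, ?_⟩
        ⟨i, fun j hj => by simp⟩
      intro j hj τ hτ heq
      rw [key i j hj] at heq
      obtain ⟨h₁, h₂⟩ := List.append_inj heq (by simp [(h.2.1 τ hτ).1])
      exact hcon j hj ⟨τ.2.2, by rw [h₁, h₂]; exact hτ⟩
    · rintro hx w ⟨hl, hw⟩ ⟨i, hi⟩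
      obtain ⟨j, hj, c, hc⟩ := hx i
      refine hw j hj _ hc ?_
      rw [← key i j hj]
      congr 3
      apply List.ext_getElem
      · simp [hl]
      · intro o h₁ h₂
        simp [hi o h₁]

end Subshift

/-! ### The graph of the SFT -/

section Graph

variable {A : Type*} {n P : ℕ} {N : TileRules}

theorem tileVertex_inj {a b : Word} {i j : ℕ} : tileVertex a i = tileVertex b j ↔ a = b ∧ i = j := by
  rw [tileVertex, tileVertex, Encodable.encode_injective.eq_iff, Prod.mk.injEq]

theorem mem_tileGraph {q : ℕ × ℕ × ℕ} : q ∈ tileGraph P N ↔ ∃ a b c, (a, b, c) ∈ N ∧ ∃ i < P,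
    q = (tileVertex a i, a.getD i 0,
      if i + 1 < P then tileVertex a (i + 1) else tileVertex b 0) := by
  simp only [tileGraph, List.mem_flatMap, List.mem_map, List.mem_range, Prod.exists]
  constructor
  · rintro ⟨a, b, c, h, i, hi, rfl⟩
    exact ⟨a, b, c, h, i, hi, rfl⟩
  · rintro ⟨a, b, c, h, i, hi, rfl⟩
    exact ⟨a, b, c, h, i, hi, rfl⟩

theorem IsTileSystem.exists_path_of_forall_pairAt (h : IsTileSystem n P N) {y : ℤ → ℕ} {r : ℤ}
    (hr : ∀ k : ℤ, PairAt P N y (r + k * P)) :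
    ∃ v : ℤ → ℕ, ∀ i, (v i, y i, v (i + 1)) ∈ tileGraph P N := by
  have hP : (0 : ℤ) < P := by exact_mod_cast h.1
  refine ⟨fun p => tileVertex (wordAt y (r + ((p - r) / P) * P) P) ((p - r) % P).toNat,
    fun p => ?_⟩
  rw [mem_tileGraph]
  obtain ⟨c, hc⟩ := hr ((p - r) / P)
  have h₁ := Int.emod_lt_of_pos (p - r) hP
  have h₂ := Int.emod_nonneg (p - r) hP.ne'
  have h₃ := Int.emod_add_mul_ediv (p - r) P
  have hlt : ((p - r) % P).toNat < P := by omega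
  refine ⟨_, _, c, hc, _, hlt, ?_⟩
  simp only [Prod.mk.injEq, true_and]
  refine ⟨?_, ?_⟩
  · rw [getD_wordAt _ _ hlt, Int.toNat_of_nonneg h₂]
    congr 1
    linarith
  · have hsucc : p + 1 - r = ((p - r) % P + 1) + ((p - r) / P) * P := by linarith
    rw [hsucc, Int.add_mul_ediv_right _ _ hP.ne', Int.add_mul_emod_self_right]
    split_ifs with hlt'
    · rw [Int.ediv_eq_zero_of_lt (by omega) (by omega), Int.emod_eq_of_lt (by omega) (by omega),
        tileVertex_inj]
      refine ⟨by rw [zero_add], by omega⟩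
    · have : (p - r) % P + 1 = P := by omega
      rw [this, Int.ediv_self hP.ne', Int.emod_self, tileVertex_inj]
      refine ⟨?_, rfl⟩
      congr 1
      ring

/-- A vertex remembers its tile and its position there, and a path leaves a tile only after the last
cell, through a rule naming the next tile. Biinfinite paths therefore spell complete adjacent tiles.
-/
theorem IsTileSystem.pairAt_of_path (h : IsTileSystem n P N) {y v : ℤ → ℕ}
    (hv : ∀ i, (v i, y i, v (i + 1)) ∈ tileGraph P N) (p : ℤ) :
    ∃ j < P, PairAt P N y (p + (j : ℕ)) := by
  simp only [mem_tileGraph, Prod.mk.injEq] at hv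
  choose a b c hN o ho hva hya hvb using hv
  have hnext : ∀ i, o i + 1 < P → a (i + 1) = a i ∧ o (i + 1) = o i + 1 := by
    intro i hi
    have := hvb i
    rwa [if_pos hi, hva, tileVertex_inj] at this
  have hlast : ∀ i, o i + 1 = P → a (i + 1) = b i ∧ o (i + 1) = 0 := by
    intro i hi
    have := hvb i
    rwa [if_neg (by omega), hva, tileVertex_inj] at this
  have hrun : ∀ i (m : ℕ), o i + m < P → a (i + m) = a i ∧ o (i + m) = o i + m := by
    intro i m
    induction m with
    | zero => simp
    | succ m ih =>
      intro hm
      obtain ⟨h₁, h₂⟩ := ih (by omega)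
      obtain ⟨h₃, h₄⟩ := hnext (i + m) (by omega)
      push_cast
      rw [← add_assoc]
      exact ⟨h₃.trans h₁, by omega⟩
  have hword : ∀ i, o i = 0 → wordAt y i P = a i := by
    intro i hi
    refine eq_wordAt (h.2.1 _ (hN i)).1 fun m hm => ?_
    obtain ⟨h₁, h₂⟩ := hrun i m (by omega)
    rw [hya, h₁, h₂, hi, zero_add]
  have hend : ∀ i, ∃ b' c', (a i, b', c') ∈ N ∧ a (i + ((P - 1 - o i : ℕ) : ℤ) + 1) = b' ∧
      o (i + ((P - 1 - o i : ℕ) : ℤ) + 1) = 0 := by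
    intro i
    have hoi := ho i
    obtain ⟨h₁, h₂⟩ := hrun i (P - 1 - o i) (by omega)
    obtain ⟨h₃, h₄⟩ := hlast (i + ((P - 1 - o i : ℕ) : ℤ)) (by omega)
    exact ⟨_, _, h₁ ▸ hN _, h₃, h₄⟩
  have hpair : ∀ i, o i = 0 → PairAt P N y i := by
    intro i hi
    obtain ⟨b', c', hN', h₁, h₂⟩ := hend i
    have hP := h.1
    have hpos : i + ((P - 1 - o i : ℕ) : ℤ) + 1 = i + P := by omega
    rw [hpos] at h₁ h₂
    exact ⟨c', by rw [hword i hi, hword _ h₂, h₁]; exact hN'⟩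
  rcases Nat.eq_zero_or_pos (o p) with h0 | h0
  · exact ⟨0, h.1, by simpa using hpair p h0⟩
  · obtain ⟨-, -, -, -, h₂⟩ := hend p
    have hop := ho p
    refine ⟨P - o p, by omega, hpair _ ?_⟩
    have hpos : p + ((P - 1 - o p : ℕ) : ℤ) + 1 = p + ((P - o p : ℕ) : ℤ) := by omega
    rwa [hpos] at h₂

theorem isGraphOf_tileGraph (e : A ≃ Fin n) (h : IsTileSystem n P N) :
    IsGraphOf e (tileGraph P N) {x | ∃ r : ℤ, ∀ k : ℤ, PairAt P N (coded e x) (r + k * P)} := by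
  refine ⟨fun q hq => ?_, ?_⟩
  · obtain ⟨a, b, c, hN, i, hi, rfl⟩ := mem_tileGraph.1 hq
    obtain ⟨hl, -, -, hlt, -⟩ := h.2.1 _ hN
    simp only at hl hlt ⊢
    rw [List.getD_eq_getElem _ _ (by omega)]
    exact hlt _ (List.getElem_mem _)
  · ext x
    constructor
    · rintro ⟨r, hr⟩
      exact h.exists_path_of_forall_pairAt hr
    · rintro ⟨v, hv⟩
      exact (h.exists_forall_pairAt_iff _).2 (h.pairAt_of_path hv)

end Graph

/-- The labels of the infinite paths in a graph. -/
def GraphCode.labels (E : GraphCode) : Set (ℕ → ℕ) :=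
  {z | ∃ v : ℕ → ℕ, ∀ i, (v i, z i, v (i + 1)) ∈ E}

/-! ### Every trace is a path label -/

section Labelling

theorem exists_mem_labels_of_finite_path {E : GraphCode} (hE : ∀ q ∈ E, ∃ q' ∈ E, q'.1 = q.2.2)
    {m : ℕ} {v z : ℕ → ℕ} (hv : ∀ s ≤ m, (v s, z s, v (s + 1)) ∈ E) :
    ∃ z' ∈ E.labels, ∀ s ≤ m, z' s = z s := by
  choose! f hfE hf using hE
  let g : ℕ → ℕ × ℕ × ℕ := fun k => f^[k] (v m, z m, v (m + 1))
  have hg : ∀ k, g k ∈ E := by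
    intro k
    induction k with
    | zero => exact hv m le_rfl
    | succ k ih =>
      simp only [g, Function.iterate_succ_apply']
      exact hfE _ ih
  have hg' : ∀ k, (g (k + 1)).1 = (g k).2.2 := by
    intro k
    have := hf _ (hg k)
    simpa only [g, Function.iterate_succ_apply'] using this
  have hg0 : g 0 = (v m, z m, v (m + 1)) := rfl
  refine ⟨fun s => if s < m then z s else (g (s - m)).2.1,
    ⟨fun s => if s < m then v s else (g (s - m)).1, fun s => ?_⟩, fun s hs => ?_⟩
  · rcases lt_trichotomy (s + 1) m with h | h | h
    · simp only [if_pos h, if_pos (by omega : s < m)]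
      exact hv s (by omega)
    · subst h
      simpa [hg0] using hv s (by omega)
    · simp only [if_neg (by omega : ¬ s < m), if_neg (by omega : ¬ s + 1 < m)]
      rw [show s + 1 - m = (s - m) + 1 by omega, hg']
      exact hg _
  · rcases hs.lt_or_eq with h | rfl
    · simp [h]
    · simp [hg0]

/-- A vertex chosen in the last set is traced back to time `0` through predecessors, and the
resulting finite path is prolonged because `E` has no dead ends. Different `m` may use different
paths. -/
theorem IsVertexLabelling.exists_mem_labels {P : ℕ} {N : TileRules} {E : GraphCode}
    {Λ : List (Word × ℕ × List ℕ)} (h : IsVertexLabelling P N E Λ)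
    (hE : ∀ q ∈ E, ∃ q' ∈ E, q'.1 = q.2.2) {T : ℕ → ℤ → Word} (hT : IsEvolution N T) {i : ℕ}
    (hi : i < P) (m : ℕ) :
    ∃ z ∈ E.labels, ∀ s ≤ m, z s = (T s 0).getD i 0 := by
  have hstep : ∀ s Q, (T s 0, i, Q) ∈ Λ → Q ≠ [] ∧ ∃ Q', (T (s + 1) 0, i, Q') ∈ Λ ∧
      ∀ q' ∈ Q', ∃ q ∈ Q, (q, (T s 0).getD i 0, q') ∈ E := by
    intro s Q hQ
    obtain ⟨hne, ⟨c, i', Q'⟩, hy, rfl, rfl, hQ'⟩ := (h _ (hT s 0) i hi).2 _ hQ rfl rfl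
    exact ⟨hne, Q', hy, hQ'⟩
  obtain ⟨⟨a, i', Q₀⟩, hQ₀, rfl, rfl⟩ := (h _ (hT 0 0) i hi).1
  choose! hne f hf hfE using hstep
  let Q : ℕ → List ℕ := fun s => Nat.rec Q₀ (fun s Q => f s Q) s
  have hQ : ∀ s, (T s 0, i', Q s) ∈ Λ := by
    intro s
    induction s with
    | zero => exact hQ₀
    | succ s ih => exact hf s _ ih
  have hpath : ∀ m, ∀ q ∈ Q m, ∃ v : ℕ → ℕ, v m = q ∧
      ∀ s < m, (v s, (T s 0).getD i' 0, v (s + 1)) ∈ E := by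
    intro m
    induction m with
    | zero => exact fun q _ => ⟨fun _ => q, rfl, by simp⟩
    | succ m ih =>
      intro q' hq'
      obtain ⟨q, hq, hqE⟩ := hfE m _ (hQ m) q' hq'
      obtain ⟨v, rfl, hv⟩ := ih q hq
      refine ⟨Function.update v (m + 1) q', by simp, fun s hs => ?_⟩
      rcases (Nat.lt_succ_iff_lt_or_eq.1 hs) with hlt | rfl
      · rw [Function.update_of_ne (by omega), Function.update_of_ne (by omega)]
        exact hv s hlt
      · rw [Function.update_of_ne (by omega), Function.update_self]
        exact hqE
  -- The letters at times `0, …, m` need edges ending in the set at time `m + 1`.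
  obtain ⟨q, hq⟩ := List.exists_mem_of_ne_nil _ (hne (m + 1) _ (hQ (m + 1)))
  obtain ⟨v, -, hv⟩ := hpath (m + 1) q hq
  exact exists_mem_labels_of_finite_path hE fun s hs => hv s (by omega)

end Labelling

/-! ### Every path label is a trace -/

section Supply

/-- The path formed by the `m` edges at `i` of an infinite path. -/
def pathSegment (g : ℕ → ℕ × ℕ × ℕ) (i m : ℕ) : List (ℕ × ℕ × ℕ) :=
  (List.range m).map fun j => g (i + j)

@[simp]
theorem length_pathSegment (g : ℕ → ℕ × ℕ × ℕ) (i m : ℕ) : (pathSegment g i m).length = m := by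
  simp [pathSegment]

theorem pathSegment_succ (g : ℕ → ℕ × ℕ × ℕ) (i m : ℕ) :
    pathSegment g i (m + 1) = g i :: pathSegment g (i + 1) m := by
  simp only [pathSegment, List.range_succ_eq_map, List.map_cons, List.map_map, add_zero]
  congr 1
  apply List.map_congr_left
  intro j _
  simp only [Function.comp, Nat.succ_eq_add_one]
  congr 1
  omega

theorem connects_pathSegment {g : ℕ → ℕ × ℕ × ℕ} (hg : ∀ i, (g i).2.2 = (g (i + 1)).1)
    {i m : ℕ} (hm : 0 < m) : Connects (pathSegment g i m) (pathSegment g (i + m) m) := by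
  obtain ⟨m, rfl⟩ := Nat.exists_eq_succ_of_ne_zero hm.ne'
  rw [Connects, pathSegment_succ g (i + _), pathSegment, List.range_succ]
  simp only [List.map_append, List.map_cons, List.map_nil, List.reverse_append,
    List.reverse_cons, List.reverse_nil, List.nil_append, List.singleton_append, List.headI_cons]
  exact hg _

theorem ContainsPaths.pathSegment_mem {E : GraphCode} {ℓ : ℕ} {Q : List (List (ℕ × ℕ × ℕ))}
    (h : ContainsPaths E ℓ Q) {g : ℕ → ℕ × ℕ × ℕ} (hgE : ∀ i, g i ∈ E)
    (hg : ∀ i, (g i).2.2 = (g (i + 1)).1) {m : ℕ} (hm : m ≤ ℓ) (i : ℕ) :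
    pathSegment g i m ∈ Q := by
  induction m generalizing i with
  | zero => exact h.1
  | succ m ih =>
    rw [pathSegment_succ]
    refine h.2 _ (ih (by omega) _) (by simpa using hm) _ (hgE i) ?_
    cases m with
    | zero => exact Or.inl rfl
    | succ m =>
      right
      rw [pathSegment_succ]
      exact hg i

/-- The tiles act as a conveyor belt. The path is cut into segments `β j` of length `ℓ`, tile `k ≥
0` initially stores `β (k + 1)`, and every `ℓ` steps the stored segments move one tile to the left
while tile `0` activates its own. -/
theorem IsSupply.exists_evolution {E : GraphCode} {ℓ f : ℕ} {N : TileRules}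
    {Q : List (List (ℕ × ℕ × ℕ))}
    {K : List (ℕ × Word × List (ℕ × ℕ × ℕ) × List (ℕ × ℕ × ℕ))} (h : IsSupply E ℓ f N Q K)
    {z : ℕ → ℕ} (hz : z ∈ E.labels) :
    ∃ T, IsEvolution N T ∧ ∀ s, (T s 0).getD f 0 = z s := by
  obtain ⟨hℓ, hQ, hinit, hstep, hlabel⟩ := h
  obtain ⟨v, hv⟩ := hz
  let g : ℕ → ℕ × ℕ × ℕ := fun i => (v i, z i, v (i + 1))
  let β : ℕ → List (ℕ × ℕ × ℕ) := fun j => pathSegment g (j * ℓ) ℓ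
  have hβQ : ∀ j, β j ∈ Q := fun j => hQ.pathSegment_mem hv (fun _ => rfl) le_rfl _
  have hβl : ∀ j, (β j).length = ℓ := fun j => length_pathSegment _ _ _
  have hβc : ∀ j, Connects (β j) (β (j + 1)) := by
    intro j
    simp only [β, Nat.succ_mul]
    exact connects_pathSegment (fun _ => rfl) hℓ
  let Inv : ℕ → (ℤ → ℕ × Word × List (ℕ × ℕ × ℕ) × List (ℕ × ℕ × ℕ)) → Prop := fun s X =>
    (∀ k, X k ∈ K ∧ (X k).1 = s % ℓ) ∧ (∀ k : ℕ, (X k).2.2.2 = β (s / ℓ + k + 1)) ∧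
      (X 0).2.2.1 = β (s / ℓ)
  have h0 : ∃ X, Inv 0 X := by
    -- Tiles at negative positions never influence tile `0`; `toNat` merely gives them admissible
    -- contents.
    choose X hXK hX0 hX using fun k : ℤ => hinit (β k.toNat) (hβQ _) (β (k.toNat + 1)) (hβQ _)
      (hβl _) (hβl _)
    refine ⟨X, fun k => ⟨hXK k, by simp [hX0]⟩, fun k => by simp [hX], by simp [hX]⟩
  have hs : ∀ s X, Inv s X → ∃ X', Inv (s + 1) X' ∧
      ∀ k, ((X k).2.1, (X (k + 1)).2.1, (X' k).2.1) ∈ N := by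
    rintro s X ⟨hXK, hXβ, hXα⟩
    have hone : ∀ k, ∃ x', x' ∈ K ∧ x'.1 = (s + 1) % ℓ ∧
        ((X k).2.1, (X (k + 1)).2.1, x'.2.1) ∈ N ∧
        ((s / ℓ = (s + 1) / ℓ ∧ x'.2.2 = (X k).2.2) ∨
        (s / ℓ + 1 = (s + 1) / ℓ ∧ x'.2.2.2 = (X (k + 1)).2.2.2 ∧
          (Connects (X k).2.2.1 (X k).2.2.2 → x'.2.2.1 = (X k).2.2.2))) := by
      intro k
      obtain ⟨⟨a, b, c⟩, hτ, h₁, h₂, hor⟩ := hstep _ (hXK k).1 _ (hXK (k + 1)).1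
        ((hXK k).2.trans (hXK (k + 1)).2.symm)
      simp only at h₁ h₂ hor
      have hdm := Nat.div_add_mod s ℓ
      rw [(hXK k).2] at hor
      rcases hor with ⟨hlt, hmem⟩ | ⟨heq, ⟨t, c', α', β'⟩, hmem, h₃, h₄, h₅, h₆⟩
      · have hdm' : s + 1 = s % ℓ + 1 + ℓ * (s / ℓ) := by omega
        refine ⟨_, hmem, ?_, ?_, Or.inl ⟨?_, rfl⟩⟩
        · rw [hdm', Nat.add_mul_mod_self_left, Nat.mod_eq_of_lt hlt]
        · rw [← h₁, ← h₂]
          exact hτ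
        · conv_rhs => rw [hdm', Nat.add_mul_div_left _ _ hℓ, Nat.div_eq_of_lt hlt, zero_add]
      · have hdm' : s + 1 = ℓ * (s / ℓ + 1) := by rw [Nat.mul_succ]; omega
        refine ⟨_, hmem, ?_, ?_, Or.inr ⟨?_, h₅, h₆⟩⟩
        · rw [hdm', Nat.mul_mod_right]
          exact h₃
        · simp only at h₄
          rw [← h₁, ← h₂, h₄]
          exact hτ
        · conv_rhs => rw [hdm', Nat.mul_div_cancel_left _ hℓ]
    choose X' hK ht hN hor using hone
    refine ⟨X', ⟨fun k => ⟨hK k, ht k⟩, fun k => ?_, ?_⟩, hN⟩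
    · rcases hor k with ⟨hd, hx⟩ | ⟨hd, hx, -⟩
      · rw [hx, ← hd, hXβ]
      · rw [hx, ← hd]
        have := hXβ (k + 1)
        push_cast at this
        rw [this]
        congr 1
        omega
    · have h0 := hXβ 0
      simp only [Nat.cast_zero, add_zero] at h0
      rcases hor 0 with ⟨hd, hx⟩ | ⟨hd, -, hx⟩
      · rw [hx, ← hd, hXα]
      · rw [← hd, ← h0]
        -- Consecutive segments of one path connect, so the stored segment does become active.
        apply hx
        rw [h0, hXα]
        exact hβc _
  obtain ⟨X₀, hX₀⟩ := h0
  choose! F hF hFN using hs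
  let X : ℕ → ℤ → ℕ × Word × List (ℕ × ℕ × ℕ) × List (ℕ × ℕ × ℕ) := fun s =>
    Nat.rec X₀ (fun s X => F s X) s
  have hX : ∀ s, Inv s (X s) := by
    intro s
    induction s with
    | zero => exact hX₀
    | succ s ih => exact hF s _ ih
  refine ⟨fun s k => (X s k).2.1, fun s k => hFN s _ (hX s) k, fun s => ?_⟩
  obtain ⟨hK, -, hα⟩ := hX s
  simp only [hlabel _ (hK 0).1, hα, (hK 0).2]
  have hlt := Nat.mod_lt s hℓ
  rw [List.getD_eq_getElem _ _ (by rw [hβl]; exact hlt)]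
  simp only [β, pathSegment, List.getElem_map, List.getElem_range, g]
  congr 1
  rw [mul_comm]
  exact Nat.div_add_mod s ℓ

end Supply

/-! ### Normal forms: soundness -/

section NFAPaths

variable {α σ : Type*} (M : NFA α σ)

theorem exists_path_of_mem_evalFrom {s t : σ} {w : List α} (h : t ∈ M.evalFrom {s} w) :
    ∃ v : ℕ → σ, v 0 = s ∧ v w.length = t ∧ ∀ (i : ℕ) (hi : i < w.length),
      v (i + 1) ∈ M.step (v i) w[i] := by
  induction w generalizing s with
  | nil =>
    rw [NFA.evalFrom_nil, Set.mem_singleton_iff] at h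
    exact ⟨fun _ => s, rfl, h.symm, by simp⟩
  | cons a w ih =>
    rw [NFA.evalFrom_cons, NFA.stepSet_singleton, NFA.mem_evalFrom_iff_exists] at h
    obtain ⟨s', hs', h⟩ := h
    obtain ⟨v, rfl, hvt, hv⟩ := ih h
    refine ⟨fun i => Nat.casesOn i s v, rfl, by simpa using hvt, fun i hi => ?_⟩
    cases i with
    | zero => simpa using hs'
    | succ i => simpa using hv i (by simpa using hi)

theorem mem_evalFrom_of_path {w : List α} {v : ℕ → σ}
    (hv : ∀ (i : ℕ) (hi : i < w.length), v (i + 1) ∈ M.step (v i) w[i]) :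
    v w.length ∈ M.evalFrom {v 0} w := by
  induction w generalizing v with
  | nil => simp
  | cons a w ih =>
    rw [NFA.evalFrom_cons, NFA.stepSet_singleton, NFA.mem_evalFrom_iff_exists]
    refine ⟨v 1, hv 0 (by simp), ?_⟩
    exact ih (v := fun i => v (i + 1)) fun i hi => hv (i + 1) (by simpa using hi)

theorem mem_evalFrom_append {s t u : σ} {w w' : List α} (h : t ∈ M.evalFrom {s} w)
    (h' : u ∈ M.evalFrom {t} w') : u ∈ M.evalFrom {s} (w ++ w') := by
  rw [NFA.evalFrom_append, NFA.mem_evalFrom_iff_exists]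
  exact ⟨t, h, h'⟩

end NFAPaths

/-! ### Compactness for infinite paths -/

section Koenig

theorem mem_labels_of_forall_finite_path {E : GraphCode} {z : ℕ → ℕ}
    (h : ∀ m, ∃ v : ℕ → ℕ, ∀ s ≤ m, (v s, z s, v (s + 1)) ∈ E) : z ∈ E.labels := by
  let V : Set ℕ := {q | q ∈ E.map (fun q => q.1) ++ E.map fun q => q.2.2}
  have hV : V.Finite := List.finite_toSet _
  have hmem : ∀ q ∈ E, q.1 ∈ V ∧ q.2.2 ∈ V := by
    intro q hq
    exact ⟨List.mem_append_left _ (List.mem_map_of_mem hq),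
      List.mem_append_right _ (List.mem_map_of_mem (f := fun q : ℕ × ℕ × ℕ => q.2.2) hq)⟩
  let t : ℕ → Set (ℕ → ℕ) := fun m =>
    Set.univ.pi (fun _ => V) ∩ ⋂ s ≤ m, {v | (v s, z s, v (s + 1)) ∈ E}
  have hclosed : ∀ m, IsClosed (⋂ s ≤ m, {v : ℕ → ℕ | (v s, z s, v (s + 1)) ∈ E}) := by
    intro m
    refine isClosed_biInter fun s _ => ?_
    have hc : Continuous fun v : ℕ → ℕ => (v s, v (s + 1)) := by fun_prop
    exact (isClosed_discrete {p : ℕ × ℕ | (p.1, z s, p.2) ∈ E}).preimage hc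
  have hcompact : IsCompact (Set.univ.pi fun _ : ℕ => V) :=
    isCompact_univ_pi fun _ => hV.isCompact
  obtain ⟨v, hv⟩ := IsCompact.nonempty_iInter_of_sequence_nonempty_isCompact_isClosed t
    (fun m => Set.inter_subset_inter_right _
      (Set.biInter_mono (fun s hs => Nat.le_succ_of_le hs) fun _ _ => subset_rfl))
    (fun m => by
      obtain ⟨v, hv⟩ := h m
      -- Past `m + 1` the given `v` may leave the finite set `V`, so it is replaced there by a
      -- constant.
      refine ⟨fun s => if s ≤ m + 1 then v s else v 0, fun s _ => ?_, ?_⟩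
      · simp only
        split_ifs with hs
        · cases s with
          | zero => exact (hmem _ (hv 0 (Nat.zero_le m))).1
          | succ s => exact (hmem _ (hv s (by omega))).2
        · exact (hmem _ (hv 0 (Nat.zero_le m))).1
      · simp only [Set.mem_iInter]
        intro s hs
        change ((if s ≤ m + 1 then v s else v 0), z s, if s + 1 ≤ m + 1 then v (s + 1) else v 0) ∈ E
        rw [if_pos (by omega), if_pos (by omega)]
        exact hv s hs)
    (hcompact.inter_right (hclosed 0)) (fun m => hcompact.isClosed.inter (hclosed m))
  refine ⟨v, fun s => ?_⟩
  have := (Set.mem_iInter.1 hv s).2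
  simp only [Set.mem_iInter] at this
  exact this s le_rfl

end Koenig

section Soundness

variable {A : Type*} {n : ℕ}

/-- Ranks of dead ends strictly decrease along edges of the core, so an infinite path in the core
meets no dead end. -/
theorem path_mem_of_core {D : SoficCode} {R C Z : List (ℕ × ℕ)} {E : GraphCode}
    (h : IsNormalForm D R C Z E) {v z : ℕ → ℕ}
    (hv : ∀ i, (v i, z i, v (i + 1)) ∈ D.edges ∧ InCore R C (v i, z i, v (i + 1))) (i : ℕ) :
    (v i, z i, v (i + 1)) ∈ E := by
  have hdead : ∀ k, ∀ δ ∈ Z, δ.2 = k → ∀ i, δ.1 ≠ v i := by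
    intro k
    induction k using Nat.strong_induction_on with
    | _ k ih =>
      rintro δ hδ rfl i hi
      obtain ⟨δ', hδ', h₁, h₂⟩ := h.2.2.1 δ hδ _ (hv i).1 (hv i).2 hi.symm
      exact ih _ h₂ δ' hδ' rfl (i + 1) h₁
  rcases h.2.2.2.2 _ (hv i).1 (hv i).2 with hE | ⟨δ, hδ, hi⟩
  · exact hE
  · exact absurd hi (hdead _ δ hδ rfl (i + 1))

theorem IsReachableList.forall_mem {E : GraphCode} {S : List ℕ} {R : List (ℕ × ℕ)}
    (h : IsReachableList E S R) {v z : ℕ → ℕ} {m : ℕ} (h0 : v 0 ∈ S)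
    (hv : ∀ i < m, (v i, z i, v (i + 1)) ∈ E) : ∀ i ≤ m, ∃ ρ ∈ R, ρ.1 = v i := by
  intro i
  induction i with
  | zero => exact fun _ => h.2.1 _ h0
  | succ i ih =>
    intro hi
    obtain ⟨ρ, hρ, hρi⟩ := ih (by omega)
    exact h.2.2 _ (hv i (by omega)) ρ hρ hρi.symm

theorem IsReachableList.exists_reflTransGen {E : GraphCode} {S : List ℕ} {R : List (ℕ × ℕ)}
    (h : IsReachableList E S R) {r : ℕ → ℕ → Prop}
    (hr : ∀ q ∈ E, r q.1 q.2.2) :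
    ∀ ρ ∈ R, ∃ s ∈ S, Relation.ReflTransGen r s ρ.1 := by
  have : ∀ k, ∀ ρ ∈ R, ρ.2 = k → ∃ s ∈ S, Relation.ReflTransGen r s ρ.1 := by
    intro k
    induction k using Nat.strong_induction_on with
    | _ k ih =>
      rintro ρ hρ rfl
      rcases h.1 ρ hρ with hs | ⟨ρ', hρ', hlt, q, hq, h₁, h₂⟩
      · exact ⟨_, hs, Relation.ReflTransGen.refl⟩
      · obtain ⟨s, hs, hsρ⟩ := ih _ hlt ρ' hρ' rfl
        refine ⟨s, hs, hsρ.tail ?_⟩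
        rw [← h₁, ← h₂]
        exact hr q hq
  exact fun ρ hρ => this _ ρ hρ rfl

theorem reflTransGen_step_iff {α σ : Type*} (M : NFA α σ) {s t : σ} :
    Relation.ReflTransGen (fun q q' => ∃ a, q' ∈ M.step q a) s t ↔ ∃ w, t ∈ M.evalFrom {s} w := by
  constructor
  · intro h
    induction h with
    | refl => exact ⟨[], by simp⟩
    | tail _ h ih =>
      obtain ⟨w, hw⟩ := ih
      obtain ⟨a, ha⟩ := h
      exact ⟨w ++ [a], mem_evalFrom_append M hw (by simpa using ha)⟩
  · rintro ⟨w, hw⟩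
    induction w generalizing s with
    | nil =>
      rw [NFA.evalFrom_nil, Set.mem_singleton_iff] at hw
      rw [hw]
    | cons a w ih =>
      rw [NFA.evalFrom_cons, NFA.stepSet_singleton, NFA.mem_evalFrom_iff_exists] at hw
      obtain ⟨s', hs', hw⟩ := hw
      exact (ih hw).head ⟨a, hs'⟩

variable [TopologicalSpace A]

theorem mem_of_forall_prefix {S : Subshift A ℕ} {x : ℕ → A}
    (h : ∀ m, ∃ y ∈ S.carrier, ∀ s ≤ m, y s = x s) : x ∈ S.carrier := by
  choose y hy hyx using h
  refine S.isClosed.mem_of_tendsto (b := Filter.atTop) (f := y) ?_ (Filter.Eventually.of_forall hy)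
  rw [tendsto_pi_nhds]
  intro s
  refine tendsto_const_nhds.congr' ?_
  filter_upwards [Filter.eventually_ge_atTop s] with m hm
  exact (hyx m s hm).symm

/-- For an automaton, prefixes of points of `S` are accepted along accessible and coaccessible
edges, and compactness gives an infinite path. Conversely, any finite path in the core extends to an
accepted word, hence its label is a factor of a point of `S`; shift invariance and closedness
conclude. -/
theorem IsNormalForm.carrier_eq {S : Subshift A ℕ} {e : A ≃ Fin n} {D : SoficCode}
    (hD : D.Represents e S) {R C Z : List (ℕ × ℕ)} {E : GraphCode}
    (h : IsNormalForm D R C Z E) : S.carrier = {x | coded e x ∈ E.labels} := by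
  obtain ⟨hR, hC, -, hE, hE'⟩ := id h
  cases D with
  | inl G =>
    obtain ⟨-, hG⟩ := hD
    rw [hG]
    ext x
    constructor
    · rintro ⟨v, hv⟩
      refine ⟨v, fun i => path_mem_of_core h (fun i => ⟨hv i, ?_⟩) i⟩
      refine ⟨hR.2.1 _ ?_, hC.2.1 _ ?_⟩
      · exact List.mem_map_of_mem (f := fun q : ℕ × ℕ × ℕ => q.1) (hv i)
      · exact List.mem_map_of_mem (f := fun q : ℕ × ℕ × ℕ => q.2.2) (hv i)
    · rintro ⟨v, hv⟩
      exact ⟨v, fun i => (hE _ (hv i)).1⟩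
  | inr M =>
    obtain ⟨hwf, hM⟩ := hD
    ext x
    constructor
    · intro hx
      classical
      have hlab : coded e x ∈ GraphCode.labels (M.1.filter fun q => InCore R C q) := by
        refine mem_labels_of_forall_finite_path fun m => ?_
        have hw : (List.range (m + 1)).map x ∈ factorLanguage S.carrier :=
          ⟨x, hx, 0, fun j hj => by simp⟩
        rw [← hM, NFA.mem_accepts] at hw
        obtain ⟨f, hf, hw⟩ := hw
        rw [NFA.mem_evalFrom_iff_exists] at hw
        obtain ⟨s, hs, hw⟩ := hw
        obtain ⟨v, rfl, rfl, hv⟩ := exists_path_of_mem_evalFrom _ hw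
        simp only [List.length_map, List.length_range, List.getElem_map, List.getElem_range] at hv hf
        have hvE : ∀ i < m + 1, (v i, coded e x i, v (i + 1)) ∈ M.1 := hv
        refine ⟨v, fun i hi => ?_⟩
        simp only [List.mem_filter, decide_eq_true_eq]
        refine ⟨hvE i (by omega), hR.forall_mem hs hvE i (by omega), ?_⟩
        -- Coaccessibility is reachability in the reversed graph, so the accepting path is read
        -- backwards from its end.
        have := hC.forall_mem (v := fun i => v (m + 1 - i)) (z := fun i => coded e x (m - i))
          (m := m + 1) hf (fun i hi => by
            refine List.mem_map.2 ⟨_, hvE (m - i) (by omega), ?_⟩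
            simp only [Prod.mk.injEq, true_and]
            exact ⟨by congr 1; omega, by congr 1; omega⟩) (m - i) (by omega)
        obtain ⟨γ, hγ, hγv⟩ := this
        refine ⟨γ, hγ, hγv.trans ?_⟩
        simp only
        congr 1
        omega
      obtain ⟨v, hv⟩ := hlab
      refine ⟨v, fun i => path_mem_of_core h (fun i => ?_) i⟩
      have := hv i
      simp only [List.mem_filter, decide_eq_true_eq] at this
      exact this
    · rintro ⟨v, hv⟩
      refine mem_of_forall_prefix fun m => ?_
      have hstep : ∀ q ∈ M.1, ∃ a, q.2.2 ∈ (AutomatonCode.toNFA e M).step q.1 a := by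
        intro q hq
        refine ⟨e.symm ⟨q.2.1, hwf q hq⟩, ?_⟩
        simpa [AutomatonCode.toNFA] using hq
      obtain ⟨ρ, hρ, hρv⟩ := (hE _ (hv 0)).2.1.1
      obtain ⟨γ, hγ, hγv⟩ := (hE _ (hv m)).2.1.2
      obtain ⟨s, hs, hsρ⟩ := hR.exists_reflTransGen
        (r := fun q q' => ∃ a, q' ∈ (AutomatonCode.toNFA e M).step q a) hstep ρ hρ
      obtain ⟨f, hf, hfγ⟩ := hC.exists_reflTransGen
        (r := Function.swap fun q q' => ∃ a, q' ∈ (AutomatonCode.toNFA e M).step q a)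
        (fun q hq => by
          obtain ⟨q', hq', rfl⟩ := List.mem_map.1 hq
          exact hstep q' hq') γ hγ
      rw [Relation.reflTransGen_swap, hγv, reflTransGen_step_iff] at hfγ
      rw [hρv, reflTransGen_step_iff] at hsρ
      obtain ⟨u, hu⟩ := hsρ
      obtain ⟨w, hw⟩ := hfγ
      have hmid := mem_evalFrom_of_path (AutomatonCode.toNFA e M)
        (w := (List.range (m + 1)).map x) (v := v) (fun i hi => by
          simp only [List.getElem_map, List.getElem_range]
          exact (hE _ (hv i)).1)
      simp only [List.length_map, List.length_range] at hmid
      have hacc : u ++ ((List.range (m + 1)).map x ++ w) ∈ (AutomatonCode.toNFA e M).accepts := by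
        rw [NFA.mem_accepts]
        refine ⟨f, hf, ?_⟩
        rw [NFA.mem_evalFrom_iff_exists]
        exact ⟨s, hs, mem_evalFrom_append _ hu (mem_evalFrom_append _ hmid hw)⟩
      rw [hM] at hacc
      obtain ⟨y, hy, i, hi⟩ := hacc
      -- The shift removes the access word `u` as well, leaving the required prefix at the origin.
      refine ⟨shift (i + u.length) y, S.mapsTo _ hy, fun j hj => ?_⟩
      have := hi (u.length + j) (by simp; omega)
      rw [List.getElem_append_right (by omega), List.getElem_append_left (by simp; omega)] at this
      simp only [Nat.add_sub_cancel_left, List.getElem_map, List.getElem_range, Nat.cast_id] at this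
      rw [← this, ← add_assoc]
      rfl

theorem IsNormalForm.wellFormed {S : Subshift A ℕ} {e : A ≃ Fin n} {D : SoficCode}
    (hD : D.Represents e S) {R C Z : List (ℕ × ℕ)} {E : GraphCode}
    (h : IsNormalForm D R C Z E) : E.WellFormed n := by
  intro q hq
  have hq' := (h.2.2.2.1 q hq).1
  cases D with
  | inl G => exact hD.1 q hq'
  | inr M => exact hD.1 q hq'

end Soundness

/-! ### Normal forms: existence -/

section Existence

theorem exists_list_of_finite {α : Type*} {s : Set α} (hs : s.Finite) :
    ∃ l : List α, ∀ x, x ∈ l ↔ x ∈ s :=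
  ⟨hs.toFinset.toList, by simp⟩

/-- The elements of a finite set paired with the first time at which they satisfy `p`. -/
theorem exists_list_first {s : Set ℕ} (hs : s.Finite) (p : ℕ → ℕ → Prop) :
    ∃ l : List (ℕ × ℕ), ∀ x, x ∈ l ↔ x.1 ∈ s ∧ p x.2 x.1 ∧ ∀ j < x.2, ¬ p j x.1 := by
  refine exists_list_of_finite (Set.Finite.of_finite_image (f := Prod.fst) (hs.subset ?_) ?_)
  · rintro _ ⟨x, hx, rfl⟩
    exact hx.1
  · rintro ⟨q, k⟩ ⟨-, h₁, h₂⟩ ⟨q', k'⟩ ⟨-, h₁', h₂'⟩ rfl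
    rcases lt_trichotomy k k' with h | rfl | h
    · exact absurd h₁ (h₂' k h)
    · rfl
    · exact absurd h₁' (h₂ k' h)

/-- `q` is reached from `S` by a path of length `k`. -/
def ReachedIn (E : GraphCode) (S : List ℕ) : ℕ → ℕ → Prop
  | 0, q => q ∈ S
  | k + 1, q => ∃ x ∈ E, ReachedIn E S k x.1 ∧ x.2.2 = q

/-- The rank is the length of a shortest access path, whose last edge starts at a vertex of smaller
rank. -/
theorem exists_isReachableList (E : GraphCode) (S : List ℕ) : ∃ R, IsReachableList E S R := by
  classical
  have hfin : {q | ∃ k, ReachedIn E S k q}.Finite := by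
    refine (List.finite_toSet (S ++ E.map fun q => q.2.2)).subset ?_
    rintro q ⟨k, hk⟩
    cases k with
    | zero => exact List.mem_append_left _ hk
    | succ k =>
      obtain ⟨x, hx, -, rfl⟩ := hk
      exact List.mem_append_right _ (List.mem_map_of_mem (f := fun q : ℕ × ℕ × ℕ => q.2.2) hx)
  obtain ⟨R, hR⟩ := exists_list_first hfin (ReachedIn E S)
  have hmem : ∀ q k, ReachedIn E S k q → ∃ j ≤ k, (q, j) ∈ R := by
    intro q k hk
    have hex : ∃ k, ReachedIn E S k q := ⟨k, hk⟩
    exact ⟨Nat.find hex, Nat.find_min' hex hk,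
      (hR _).2 ⟨hex, Nat.find_spec hex, fun j hj => Nat.find_min hex hj⟩⟩
  refine ⟨R, ?_, ?_, ?_⟩
  · rintro ⟨q, k⟩ hq
    obtain ⟨-, hk, -⟩ := (hR _).1 hq
    cases k with
    | zero => exact Or.inl hk
    | succ k =>
      obtain ⟨x, hx, hxk, rfl⟩ := hk
      obtain ⟨j, hj, hjR⟩ := hmem _ _ hxk
      exact Or.inr ⟨_, hjR, Nat.lt_succ_of_le hj, x, hx, rfl, rfl⟩
  · intro s hs
    obtain ⟨j, -, hj⟩ := hmem s 0 hs
    exact ⟨_, hj, rfl⟩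
  · rintro x hx ⟨q, k⟩ hq rfl
    obtain ⟨-, hk, -⟩ := (hR _).1 hq
    obtain ⟨j, -, hj⟩ := hmem x.2.2 (k + 1) ⟨x, hx, hk, rfl⟩
    exact ⟨_, hj, rfl⟩

/-- There is a path of length `k` in `E` starting at `q`. -/
def PathFrom (E : GraphCode) : ℕ → ℕ → Prop
  | 0, _ => True
  | k + 1, q => ∃ x ∈ E, x.1 = q ∧ PathFrom E k x.2.2

theorem PathFrom.mono {E : GraphCode} {j k q : ℕ} (h : PathFrom E k q) (hjk : j ≤ k) :
    PathFrom E j q := by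
  induction k generalizing j q with
  | zero =>
    obtain rfl : j = 0 := by omega
    exact h
  | succ k ih =>
    cases j with
    | zero => trivial
    | succ j =>
      obtain ⟨x, hx, hxq, hk⟩ := h
      exact ⟨x, hx, hxq, ih hk (by omega)⟩

theorem exists_edge_forall_pathFrom {E : GraphCode} {q : ℕ} (h : ∀ k, PathFrom E k q) :
    ∃ x ∈ E, x.1 = q ∧ ∀ k, PathFrom E k x.2.2 := by
  by_contra hcon
  push Not at hcon
  choose! f hf using hcon
  -- If every edge from `q` failed at some length `f x`, the sum would bound all these lengths at
  -- once, and a longer path from `q` would be impossible.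
  obtain ⟨x, hx, hxq, hk⟩ := h ((E.map f).sum + 1)
  exact hf x hx hxq (hk.mono (List.le_sum_of_mem (List.mem_map_of_mem hx)))

/-- A dead end is ranked by the least length for which no path starts there; following an edge
lowers this number. -/
theorem exists_isNormalForm (D : SoficCode) : ∃ R C Z E, IsNormalForm D R C Z E := by
  classical
  obtain ⟨R, hR⟩ := exists_isReachableList D.edges D.starts
  obtain ⟨C, hC⟩ := exists_isReachableList D.edges.reversed D.finals
  set E₀ : GraphCode := D.edges.filter fun q => InCore R C q with hE₀
  have hmem : ∀ q, q ∈ E₀ ↔ q ∈ D.edges ∧ InCore R C q := by simp [hE₀]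
  obtain ⟨Z, hZ⟩ := exists_list_first (s := {q | ∃ x ∈ E₀, x.2.2 = q}) (by
    refine (List.finite_toSet (E₀.map fun q => q.2.2)).subset ?_
    rintro q ⟨x, hx, rfl⟩
    exact List.mem_map_of_mem (f := fun q : ℕ × ℕ × ℕ => q.2.2) hx) (fun k q => ¬ PathFrom E₀ k q)
  have hZmem : ∀ x ∈ E₀, ∀ k, ¬ PathFrom E₀ k x.2.2 → ∃ j ≤ k, (x.2.2, j) ∈ Z := by
    intro x hx k hk
    have hex : ∃ k, ¬ PathFrom E₀ k x.2.2 := ⟨k, hk⟩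
    exact ⟨Nat.find hex, Nat.find_min' hex hk,
      (hZ _).2 ⟨⟨x, hx, rfl⟩, Nat.find_spec hex, fun j hj => Nat.find_min hex hj⟩⟩
  refine ⟨R, C, Z, E₀.filter fun q => ∀ k, PathFrom E₀ k q.2.2, hR, hC, ?_, ?_, ?_⟩
  · rintro ⟨q, k⟩ hδ x hx hcore rfl
    obtain ⟨-, hk, -⟩ := (hZ _).1 hδ
    have hxE := (hmem x).2 ⟨hx, hcore⟩
    cases k with
    | zero => exact absurd trivial hk
    | succ k =>
      obtain ⟨j, hj, hjZ⟩ := hZmem x hxE k fun hp => hk ⟨x, hxE, rfl, hp⟩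
      exact ⟨_, hjZ, rfl, Nat.lt_succ_of_le hj⟩
  · intro x hx
    simp only [List.mem_filter, decide_eq_true_eq] at hx ⊢
    obtain ⟨y, hy, hyx, hyk⟩ := exists_edge_forall_pathFrom hx.2
    exact ⟨((hmem x).1 hx.1).1, ((hmem x).1 hx.1).2, y, ⟨hy, hyk⟩, hyx⟩
  · intro x hx hcore
    have hxE := (hmem x).2 ⟨hx, hcore⟩
    by_cases hp : ∀ k, PathFrom E₀ k x.2.2
    · left
      simp only [List.mem_filter, decide_eq_true_eq]
      exact ⟨hxE, hp⟩
    · push Not at hp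
      obtain ⟨k, hk⟩ := hp
      obtain ⟨j, -, hj⟩ := hZmem x hxE k hk
      exact Or.inr ⟨_, hj, rfl⟩

theorem exists_represents_of_isSofic {A : Type*} [TopologicalSpace A] {n : ℕ} (e : A ≃ Fin n)
    {S : Subshift A ℕ} (hS : IsSofic S) : ∃ D : SoficCode, D.Represents e S := by
  obtain ⟨σ, _, M, hM⟩ := hS
  let g := Fintype.equivFin σ
  have hfin : {x : ℕ × ℕ × ℕ | ∃ s a, x = ((g s : ℕ), (e a : ℕ), (g (M.step s a) : ℕ))}.Finite := by
    have : Finite A := Finite.of_equiv _ e.symm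
    refine (Set.finite_range fun p : σ × A =>
      ((g p.1 : ℕ), (e p.2 : ℕ), (g (M.step p.1 p.2) : ℕ))).subset ?_
    rintro _ ⟨s, a, rfl⟩
    exact ⟨(s, a), rfl⟩
  obtain ⟨E, hE⟩ := exists_list_of_finite hfin
  obtain ⟨F, hF⟩ := exists_list_of_finite ((Set.toFinite M.accept).image fun s => (g s : ℕ))
  have hstep : ∀ s a t, t ∈ (AutomatonCode.toNFA e (E, [(g M.start : ℕ)], F)).step (g s) a ↔
      t = g (M.step s a) := by
    intro s a t
    change ((g s : ℕ), (e a : ℕ), t) ∈ E ↔ _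
    rw [hE]
    constructor
    · rintro ⟨s', a', h⟩
      simp only [Prod.mk.injEq, Fin.val_inj, EmbeddingLike.apply_eq_iff_eq] at h
      obtain ⟨rfl, rfl, h⟩ := h
      exact h
    · rintro rfl
      exact ⟨s, a, rfl⟩
  have heval : ∀ (w : List A) s, (AutomatonCode.toNFA e (E, [(g M.start : ℕ)], F)).evalFrom
      {(g s : ℕ)} w = {(g (M.evalFrom s w) : ℕ)} := by
    intro w
    induction w with
    | nil => simp
    | cons a w ih =>
      intro s
      rw [NFA.evalFrom_cons, NFA.stepSet_singleton, DFA.evalFrom_cons, ← ih]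
      congr 1
      ext t
      rw [hstep, Set.mem_singleton_iff]
  refine ⟨Sum.inr (E, [(g M.start : ℕ)], F), ?_, ?_⟩
  · intro q hq
    obtain ⟨s, a, rfl⟩ := (hE q).1 hq
    exact (e a).2
  · rw [← hM]
    ext w
    have hstart : (AutomatonCode.toNFA e (E, [(g M.start : ℕ)], F)).start =
        {(g M.start : ℕ)} := by
      ext t
      simp [AutomatonCode.toNFA]
    rw [NFA.mem_accepts, hstart, heval, DFA.mem_accepts, DFA.eval]
    constructor
    · rintro ⟨t, ht, rfl⟩
      obtain ⟨s, hs, h⟩ := (hF _).1 ht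
      rw [Fin.val_inj, EmbeddingLike.apply_eq_iff_eq] at h
      rwa [← h]
    · intro h
      exact ⟨_, (hF _).2 ⟨_, h, rfl⟩, rfl⟩

end Existence

/-! ### Two cycles with different labels -/

/-- Two cycles `V true` and `V false` of the same length `L` at the same vertex `p` of `E`, with
labels `B true` and `B false` that differ for the first time at `κ`. -/
structure TwoCycles (E : GraphCode) where
  L : ℕ
  κ : ℕ
  p : ℕ
  B : Bool → ℕ → ℕ
  V : Bool → ℕ → ℕ
  κ_lt : κ < L
  V_zero : ∀ b, V b 0 = p
  V_end : ∀ b, V b L = p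
  edge_mem : ∀ b, ∀ i < L, (V b i, B b i, V b (i + 1)) ∈ E
  B_eq : ∀ i < κ, B true i = B false i
  B_ne : B true κ ≠ B false κ

section TwoCyclesExistence

variable {E : GraphCode}

/-- The labels of the paths that start at `p` and return to `p` infinitely often. -/
def recurrentLabels (E : GraphCode) (p : ℕ) : Set (ℕ → ℕ) :=
  {z | ∃ v : ℕ → ℕ, (∀ i, (v i, z i, v (i + 1)) ∈ E) ∧ v 0 = p ∧ ∀ k, ∃ m > k, v m = p}

theorem cycle_edge_mem {v z : ℕ → ℕ} (hv : ∀ i, (v i, z i, v (i + 1)) ∈ E) {m : ℕ} (hm : 0 < m)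
    (hvm : v m = v 0) (i : ℕ) : (v (i % m), z (i % m), v ((i + 1) % m)) ∈ E := by
  have hlt := Nat.mod_lt i hm
  rcases Nat.lt_or_ge (i % m + 1) m with h | h
  · rw [Nat.add_mod, Nat.mod_eq_of_lt (a := i % m + 1 % m)]
    · rw [Nat.mod_eq_of_lt (by omega : 1 < m)]
      exact hv _
    · rw [Nat.mod_eq_of_lt (by omega : 1 < m)]
      exact h
  · have h' : i % m + 1 = m := by omega
    have : (i + 1) % m = 0 := by
      rw [← Nat.mod_add_mod, h', Nat.mod_self]
    have hi := hv (i % m)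
    rw [h', hvm] at hi
    rwa [this]

/-- If two labels differ at `k`, each is cut at a return to `p` after `k`. Repeating the two closed
paths up to the common length `m * m'` gives cycles whose labels still differ at `k`. -/
theorem subsingleton_recurrentLabels (h : IsEmpty (TwoCycles E)) (p : ℕ) :
    (recurrentLabels E p).Subsingleton := by
  rintro z ⟨v, hv, hv0, hvp⟩ z' ⟨v', hv', hv0', hvp'⟩
  by_contra hne
  obtain ⟨k, hk⟩ := Function.ne_iff.1 hne
  obtain ⟨m, hm, hvm⟩ := hvp k
  obtain ⟨m', hm', hvm'⟩ := hvp' k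
  classical
  have hex : ∃ i, z (i % m) ≠ z' (i % m') :=
    ⟨k, by rwa [Nat.mod_eq_of_lt hm, Nat.mod_eq_of_lt hm']⟩
  have hle : Nat.find hex ≤ k :=
    Nat.find_min' hex (by rwa [Nat.mod_eq_of_lt hm, Nat.mod_eq_of_lt hm'])
  refine h.false ⟨m * m', Nat.find hex, p, fun b i => if b then z (i % m) else z' (i % m'),
    fun b i => if b then v (i % m) else v' (i % m'), ?_, ?_, ?_, ?_, ?_, ?_⟩
  · calc Nat.find hex ≤ k := hle
      _ < m := hm
      _ ≤ m * m' := Nat.le_mul_of_pos_right _ (by omega)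
  · intro b
    cases b <;> simp [hv0, hv0']
  · intro b
    cases b <;> simp [hv0, hv0']
  · intro b i _
    cases b
    · simpa using cycle_edge_mem hv' (by omega) (hvm'.trans hv0'.symm) i
    · simpa using cycle_edge_mem hv (by omega) (hvm.trans hv0.symm) i
  · intro i hi
    simpa using Nat.find_min hex hi
  · simpa using Nat.find_spec hex

/-- Some vertex occurs infinitely often on each path, so a label is a finite word followed by a
recurrent label. Without two cycles, the word and the vertex determine the label, and there are
countably many such pairs. -/
theorem nonempty_twoCycles (h : ¬ E.labels.Countable) : Nonempty (TwoCycles E) := by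
  by_contra hcon
  rw [not_nonempty_iff] at hcon
  apply h
  have hsub : E.labels ⊆ ⋃ (w : List ℕ) (p : ℕ), {z | (∀ i (hi : i < w.length), z i = w[i]) ∧
      (fun i => z (w.length + i)) ∈ recurrentLabels E p} := by
    rintro z ⟨v, hv⟩
    have hfin : ∀ i, v i ∈ E.map fun q => q.1 := fun i =>
      List.mem_map_of_mem (f := fun q : ℕ × ℕ × ℕ => q.1) (hv i)
    have : Finite {q // q ∈ E.map fun q => q.1} := (List.finite_toSet _).to_subtype
    obtain ⟨⟨p, hp⟩, hinf⟩ := Finite.exists_infinite_fiber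
      (fun i => (⟨v i, hfin i⟩ : {q // q ∈ E.map fun q => q.1}))
    have hio : ∀ k, ∃ m > k, v m = p := by
      intro k
      obtain ⟨m, hm, hkm⟩ := (Set.infinite_coe_iff.1 hinf).exists_gt k
      exact ⟨m, hkm, congrArg Subtype.val hm⟩
    obtain ⟨m, -, hm⟩ := hio 0
    simp only [Set.mem_iUnion]
    refine ⟨(List.range m).map z, p, by simp, fun i => v (m + i), fun i => ?_, by simpa using hm,
      fun k => ?_⟩
    · simpa [add_assoc] using hv (m + i)
    · obtain ⟨m', hm', hvm'⟩ := hio (m + k)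
      exact ⟨m' - m, by omega, by simpa [Nat.add_sub_cancel' (by omega : m ≤ m')] using hvm'⟩
  refine Set.Countable.mono hsub ?_
  refine Set.countable_iUnion fun w => Set.countable_iUnion fun p => Set.Subsingleton.countable ?_
  rintro z ⟨hz, hzr⟩ z' ⟨hz', hzr'⟩
  have heq := subsingleton_recurrentLabels hcon p hzr hzr'
  funext i
  rcases Nat.lt_or_ge i w.length with hi | hi
  · rw [hz i hi, hz' i hi]
  · have := congrFun heq (i - w.length)
    simpa [Nat.add_sub_cancel' hi] using this

end TwoCyclesExistence

/-! ### The tiles -/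

/-- Paths in `E`, as lists of edges. -/
def IsPathIn (E : GraphCode) (β : List (ℕ × ℕ × ℕ)) : Prop :=
  (∀ q ∈ β, q ∈ E) ∧ β.IsChain fun q q' => q.2.2 = q'.1

theorem finite_paths (E : GraphCode) (ℓ : ℕ) : {β | IsPathIn E β ∧ β.length ≤ ℓ}.Finite := by
  have : Finite {q // q ∈ E} := (List.finite_toSet E).to_subtype
  refine ((List.finite_length_le {q // q ∈ E} ℓ).image (List.map Subtype.val)).subset ?_
  rintro β ⟨hβ, hl⟩
  refine ⟨β.attach.map fun q => ⟨q.1, hβ.1 _ q.2⟩, by simpa using hl, ?_⟩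
  rw [List.map_map]
  exact List.attach_map_subtype_val β

/-- The paths of length `ℓ` in `E`. -/
def PathOfLength (E : GraphCode) (ℓ : ℕ) : Type :=
  {β : List (ℕ × ℕ × ℕ) // IsPathIn E β ∧ β.length = ℓ}

instance (E : GraphCode) (ℓ : ℕ) : Finite (PathOfLength E ℓ) :=
  ((finite_paths E ℓ).subset fun _ h => ⟨h.1, h.2.le⟩).to_subtype

namespace TwoCycles

variable {E : GraphCode} (c : TwoCycles E)

/-- The time after which the tiles return to their initial form. -/
def period : ℕ := 4 * c.L

/-- A tile carries an active path and a stored path. -/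
abbrev State : Type := PathOfLength E c.period × PathOfLength E c.period

/-- The number of bits that encode a state. -/
noncomputable def bits : ℕ := Nat.card c.State

/-- The bits that encode a state. -/
noncomputable def bit (s : c.State) (k : ℕ) : Bool :=
  decide ((Finite.equivFin c.State s : ℕ) = k)

/-- The label of the periodic word `uuuv`, where `u` and `v` are the labels of the two cycles. -/
def mark (j : ℕ) : ℕ := c.B (decide (j / c.L % 4 = 3)) (j % c.L)

/-- The vertices on the path with label `mark`. -/
def markVertex (j : ℕ) : ℕ := c.V (decide (j / c.L % 4 = 3)) (j % c.L)

/-- The letter of the cell `φ` in a block of `L` cells that displays the bit `x` at time `t`, when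
it still contains the end of the label of the cycle of the previous bit `y`. -/
def dataLetter (x y : Bool) (t φ : ℕ) : ℕ :=
  -- The block is a window on the concatenation of the labels for `y`, `x`, `x`, which slides left
  -- by one letter per step. Only positions below `κ` of the third copy are reached, where both
  -- labels agree, so the next bit need not be known.
  if c.κ + 1 + t % c.L + φ < c.L then c.B y (c.κ + 1 + t % c.L + φ)
  else if c.κ + 1 + t % c.L + φ < 2 * c.L then c.B x (c.κ + 1 + t % c.L + φ - c.L)
  else c.B x (c.κ + 1 + t % c.L + φ - 2 * c.L)

/-- The possible vertices for the cell described by `dataLetter`. -/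
def dataVertices (x y : Bool) (t φ : ℕ) : List ℕ :=
  if c.κ + 1 + t % c.L + φ < c.L then [c.V y (c.κ + 1 + t % c.L + φ)]
  else if c.κ + 1 + t % c.L + φ < 2 * c.L then [c.V x (c.κ + 1 + t % c.L + φ - c.L)]
  else [c.V true (c.κ + 1 + t % c.L + φ - 2 * c.L), c.V false (c.κ + 1 + t % c.L + φ - 2 * c.L)]

/-- The length of the part of a tile that follows the marker. -/
noncomputable def tailLength : ℕ := 2 * c.period + 1 + c.bits * c.L + 1

/-- The length of the runs of equal letters in the marker. -/
noncomputable def run : ℕ := c.tailLength + 1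

/-- The length of the marker. -/
noncomputable def markerLength : ℕ := (c.period + 2) * c.run

/-- The length of the tiles. -/
noncomputable def tileLength : ℕ := c.markerLength + c.tailLength

/-- The letter of the cell `o` of the tile at time `t` with state `s` and previous state `s'`. -/
noncomputable def tileLetter (t : ℕ) (s s' : c.State) (o : ℕ) : ℕ :=
  if o < c.markerLength then c.mark (t + o / c.run)
  else if o < c.markerLength + (2 * c.period + 1) then c.mark (t + (o - c.markerLength))
  else if o + 1 < c.tileLength then
    c.dataLetter (c.bit s ((o - (c.markerLength + (2 * c.period + 1))) / c.L))
      (c.bit s' ((o - (c.markerLength + (2 * c.period + 1))) / c.L)) t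
      ((o - (c.markerLength + (2 * c.period + 1))) % c.L)
  else (s.1.1.getD t default).2.1

/-- The possible vertices for the cell described by `tileLetter`. -/
noncomputable def tileVertices (t : ℕ) (s s' : c.State) (o : ℕ) : List ℕ :=
  if o < c.markerLength then [c.markVertex (t + o / c.run)]
  else if o < c.markerLength + (2 * c.period + 1) then [c.markVertex (t + (o - c.markerLength))]
  else if o + 1 < c.tileLength then
    c.dataVertices (c.bit s ((o - (c.markerLength + (2 * c.period + 1))) / c.L))
      (c.bit s' ((o - (c.markerLength + (2 * c.period + 1))) / c.L)) t
      ((o - (c.markerLength + (2 * c.period + 1))) % c.L)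
  else [(s.1.1.getD t default).1]

/-- The tile at time `t` with state `s` and previous state `s'`. -/
noncomputable def tile (t : ℕ) (s s' : c.State) : Word :=
  (List.range c.tileLength).map (c.tileLetter t s s')

theorem L_pos : 0 < c.L := (Nat.zero_le _).trans_lt c.κ_lt

theorem period_pos : 0 < c.period := by
  have := c.L_pos
  unfold period
  omega

/-! ### The primitive periodic word `uuuv` -/

section Mark

theorem mark_edge_mem (j : ℕ) : (c.markVertex j, c.mark j, c.markVertex (j + 1)) ∈ E := by
  have hL := c.L_pos
  have hlt := Nat.mod_lt j hL
  have hdm := Nat.div_add_mod j c.L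
  rcases Nat.lt_or_ge (j % c.L + 1) c.L with h | h
  · have h₁ : j + 1 = j % c.L + 1 + c.L * (j / c.L) := by omega
    have h₂ : (j + 1) / c.L = j / c.L := by
      conv_lhs => rw [h₁, Nat.add_mul_div_left _ _ hL, Nat.div_eq_of_lt h, zero_add]
    have h₃ : (j + 1) % c.L = j % c.L + 1 := by
      conv_lhs => rw [h₁, Nat.add_mul_mod_self_left, Nat.mod_eq_of_lt h]
    rw [markVertex, markVertex, mark, h₂, h₃]
    exact c.edge_mem _ _ hlt
  · have h₁ : j + 1 = c.L * (j / c.L + 1) := by rw [Nat.mul_succ]; omega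
    have h₂ : c.markVertex (j + 1) = c.V (decide (j / c.L % 4 = 3)) (j % c.L + 1) := by
      have h₃ : (j + 1) % c.L = 0 := by rw [h₁, Nat.mul_mod_right]
      rw [markVertex, h₃, c.V_zero, show j % c.L + 1 = c.L by omega, c.V_end]
    rw [h₂]
    exact c.edge_mem _ _ hlt

theorem mark_add_period (j : ℕ) : c.mark (j + c.period) = c.mark j := by
  have hL := c.L_pos
  rw [mark, mark, period, Nat.add_mul_mod_self_right, Nat.add_mul_div_right _ _ hL]
  simp

theorem markVertex_add_period (j : ℕ) : c.markVertex (j + c.period) = c.markVertex j := by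
  have hL := c.L_pos
  rw [markVertex, markVertex, period, Nat.add_mul_mod_self_right, Nat.add_mul_div_right _ _ hL]
  simp

theorem mark_eq_of_mod_eq {i j : ℕ} (h : i % c.period = j % c.period) : c.mark i = c.mark j := by
  have hp : Function.Periodic c.mark c.period := c.mark_add_period
  rw [← hp.map_mod_nat i, h, hp.map_mod_nat]

theorem mark_ne : c.mark (2 * c.L + c.κ) ≠ c.mark (3 * c.L + c.κ) := by
  have hL := c.L_pos
  have h : ∀ m, c.mark (m * c.L + c.κ) = c.B (decide (m % 4 = 3)) c.κ := by
    intro m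
    rw [mark, add_comm, Nat.add_mul_mod_self_right, Nat.add_mul_div_right _ _ hL,
      Nat.div_eq_of_lt c.κ_lt, Nat.mod_eq_of_lt c.κ_lt, zero_add]
  rw [h, h]
  simpa using c.B_ne.symm

/-- Absence of a change during one whole period would make `mark` constant, against `mark_ne`. -/
theorem exists_mark_ne_succ (i : ℕ) :
    ∃ h < c.period, c.mark (i + h) ≠ c.mark (i + h + 1) := by
  by_contra hcon
  push Not at hcon
  have hall : ∀ j, c.mark j = c.mark (j + 1) := by
    intro j
    have hpos := c.period_pos
    obtain ⟨d, hd⟩ : ∃ d, i ≤ j + d * c.period := ⟨i, by nlinarith⟩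
    have hm : (i + (j + d * c.period - i) % c.period) % c.period = j % c.period := by
      rw [Nat.add_mod_mod, show i + (j + d * c.period - i) = j + d * c.period by omega,
        Nat.add_mul_mod_self_right]
    have hm' : (i + (j + d * c.period - i) % c.period + 1) % c.period = (j + 1) % c.period :=
      Nat.ModEq.add_right 1 hm
    rw [← c.mark_eq_of_mod_eq hm, ← c.mark_eq_of_mod_eq hm']
    exact hcon _ (Nat.mod_lt _ hpos)
  have hconst : ∀ j, c.mark j = c.mark 0 := by
    intro j
    induction j with
    | zero => rfl
    | succ j ih => rw [← hall, ih]
  exact c.mark_ne ((hconst _).trans (hconst _).symm)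

/-- The word `uuuv` is primitive. -/
theorem exists_mark_add_ne {δ : ℕ} (hδ : 0 < δ) (hδ' : δ < c.period) :
    ∃ j, c.mark (j + δ) ≠ c.mark j := by
  by_contra hcon
  push Not at hcon
  have hL := c.L_pos
  have hδp : Function.Periodic c.mark δ := hcon
  have hp : Function.Periodic c.mark c.period := c.mark_add_period
  set g := Nat.gcd δ c.period with hg
  have hgp : Function.Periodic c.mark g := by
    intro j
    have hlt : Nat.gcd δ c.period < c.period := (Nat.gcd_le_left _ hδ).trans_lt hδ'
    obtain ⟨a, -, ha⟩ := Nat.exists_mul_mod_eq_gcd hlt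
    -- The gcd is a multiple of `δ` modulo the period, so it is itself a period of `mark`.
    rw [← hδp.nat_mul a j, mul_comm]
    apply c.mark_eq_of_mod_eq
    refine Nat.ModEq.add_left j ?_
    rw [Nat.ModEq, Nat.cast_id, ha, Nat.mod_eq_of_lt hlt]
  have hgpos : 0 < g := Nat.gcd_pos_of_pos_left _ hδ
  -- A proper divisor of `4 * L` is at most `2 * L`. On positions below `2 * L` the shift by `L`
  -- only compares copies of `u`, and these positions cover all residues modulo `g`; hence `u = v`.
  have hg2 : g ≤ 2 * c.L := by
    obtain ⟨d, hd⟩ : g ∣ c.period := Nat.gcd_dvd_right _ _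
    have hle : g ≤ δ := Nat.gcd_le_left _ hδ
    have hd2 : 2 ≤ d := by
      by_contra hd2
      interval_cases d <;> omega
    have : c.period = 4 * c.L := rfl
    nlinarith
  have hfirst : ∀ j < 2 * c.L, c.mark j = c.mark (j + c.L) := by
    intro j hj
    rw [mark, mark, Nat.add_mod_right, Nat.add_div_right _ hL]
    have : j / c.L < 2 := Nat.div_lt_of_lt_mul (by linarith)
    generalize j / c.L = x at this
    interval_cases x <;> rfl
  have hall : ∀ j, c.mark j = c.mark (j + c.L) := by
    intro j
    have hlt := Nat.mod_lt j hgpos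
    have h₁ := hfirst (j % g) (by omega)
    rw [hgp.map_mod_nat] at h₁
    rw [h₁, ← hgp.map_mod_nat (j % g + c.L), Nat.mod_add_mod, hgp.map_mod_nat]
  apply c.mark_ne
  rw [hall]
  congr 1
  ring

theorem eq_of_forall_mark_eq {t t' : ℕ} (ht : t < c.period) (ht' : t' < c.period)
    (h : ∀ j < c.period, c.mark (t + j) = c.mark (t' + j)) : t = t' := by
  have key : ∀ {t t' : ℕ}, t' < c.period → (∀ j < c.period, c.mark (t + j) = c.mark (t' + j)) →
      ¬ t < t' := by
    intro t t' ht' h hlt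
    obtain ⟨j, hj⟩ := c.exists_mark_add_ne (δ := t' - t) (by omega) (by omega)
    apply hj
    have hpos := c.period_pos
    have hm : ∀ a ≤ c.period, (a + (j + c.period - a) % c.period) % c.period = j % c.period := by
      intro a ha
      rw [Nat.add_mod_mod, show a + (j + c.period - a) = j + c.period by omega,
        Nat.add_mod_right]
    have h₁ := h ((j + c.period - t) % c.period) (Nat.mod_lt _ hpos)
    rw [c.mark_eq_of_mod_eq (hm t (by omega))] at h₁
    rw [h₁]
    apply c.mark_eq_of_mod_eq
    rw [show t' + (j + c.period - t) % c.period = t' - t + (t + (j + c.period - t) % c.period) by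
      omega, add_comm j]
    exact (Nat.ModEq.add_left _ (hm t (by omega))).symm
  rcases lt_trichotomy t t' with hlt | heq | hlt
  · exact absurd hlt (key ht' h)
  · exact heq
  · exact absurd hlt (key ht fun j hj => (h j hj).symm)

end Mark

/-! ### Storing a bit in a block of `L` cells -/

section Data

theorem succ_mod (t : ℕ) : (t % c.L + 1 < c.L ∧ (t + 1) % c.L = t % c.L + 1) ∨
    (t % c.L + 1 = c.L ∧ (t + 1) % c.L = 0) := by
  have hL := c.L_pos
  have hlt := Nat.mod_lt t hL
  rw [← Nat.mod_add_mod]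
  rcases Nat.lt_or_ge (t % c.L + 1) c.L with h | h
  · exact Or.inl ⟨h, Nat.mod_eq_of_lt h⟩
  · have h' : t % c.L + 1 = c.L := by omega
    exact Or.inr ⟨h', by rw [h', Nat.mod_self]⟩

theorem B_eq_of_lt (x y : Bool) {i : ℕ} (hi : i < c.κ) : c.B x i = c.B y i := by
  cases x <;> cases y <;> simp [c.B_eq i hi]

/-- At every time exactly this cell shows the letter at `κ` that distinguishes the two cycles, which
makes the current bit readable. -/
theorem dataLetter_visible (x y : Bool) (t : ℕ) :
    c.dataLetter x y t (c.L - 1 - t % c.L) = c.B x c.κ := by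
  have hlt := Nat.mod_lt t c.L_pos
  have hκ := c.κ_lt
  rw [dataLetter, if_neg (by omega), if_pos (by omega)]
  congr 1
  omega

/-- The rightmost cell is already beyond the label for the previous bit, so the letter entering the
block is determined by the current bit alone. -/
theorem dataLetter_last (x y y' : Bool) (t : ℕ) :
    c.dataLetter x y t (c.L - 1) = c.dataLetter x y' t (c.L - 1) := by
  have hL := c.L_pos
  have h : ¬ c.κ + 1 + t % c.L + (c.L - 1) < c.L := by omega
  simp only [dataLetter, if_neg h]

/-- The letters of a block move to the left. -/
theorem dataLetter_succ {x y x' y' : Bool} {t t' φ : ℕ} (ht : t' % c.L = (t + 1) % c.L)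
    (h : (t + 1) % c.L ≠ 0 → x' = x ∧ y' = y) (h0 : (t + 1) % c.L = 0 → y' = x)
    (hφ : φ + 1 < c.L) : c.dataLetter x' y' t' φ = c.dataLetter x y t (φ + 1) := by
  have hκ := c.κ_lt
  rw [dataLetter, dataLetter, ht]
  rcases c.succ_mod t with ⟨h₁, h₂⟩ | ⟨h₁, h₂⟩
  · obtain ⟨rfl, rfl⟩ := h (by omega)
    rw [h₂, show c.κ + 1 + (t % c.L + 1) + φ = c.κ + 1 + t % c.L + (φ + 1) by ring]
  · obtain rfl := h0 h₂
    rw [h₂, if_neg (by omega : ¬ c.κ + 1 + t % c.L + (φ + 1) < c.L)]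
    by_cases hlt : c.κ + 1 + 0 + φ < c.L
    · rw [if_pos hlt, if_pos (by omega)]
      congr 1
      omega
    -- These letters were shown before the new bit was chosen; they lie in the common prefix, so
    -- they remain valid for either choice.
    · rw [if_neg hlt, if_pos (by omega), if_neg (by omega), c.B_eq_of_lt x' y' (by omega)]
      congr 1
      omega

theorem dataVertices_ne_nil (x y : Bool) (t φ : ℕ) : c.dataVertices x y t φ ≠ [] := by
  unfold dataVertices
  split_ifs <;> simp

/-- While the common prefix of a future cycle is shown, the vertices of both cycles are kept. Once
the bit is fixed, the set shrinks to one of them, which still has a predecessor. -/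
theorem dataVertices_succ {x y x' y' : Bool} {t t' φ : ℕ} (ht : t' % c.L = (t + 1) % c.L)
    (h : (t + 1) % c.L ≠ 0 → x' = x ∧ y' = y) (h0 : (t + 1) % c.L = 0 → y' = x)
    (hφ : φ < c.L) : ∀ q' ∈ c.dataVertices x' y' t' φ, ∃ q ∈ c.dataVertices x y t φ,
      (q, c.dataLetter x y t φ, q') ∈ E := by
  have hκ := c.κ_lt
  rw [dataVertices, dataVertices, dataLetter, ht]
  rcases c.succ_mod t with ⟨h₁, h₂⟩ | ⟨h₁, h₂⟩
  · obtain ⟨rfl, rfl⟩ := h (by omega)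
    rw [h₂, show c.κ + 1 + (t % c.L + 1) + φ = c.κ + 1 + t % c.L + φ + 1 by ring]
    generalize hu : c.κ + 1 + t % c.L + φ = u
    rcases lt_trichotomy (u + 1) c.L with hlt | heq | hgt
    · simpa [hlt, (by omega : u < c.L)] using c.edge_mem y' u (by omega)
    · have := c.edge_mem y' u (by omega)
      rw [heq, c.V_end] at this
      simpa [heq, (by omega : u < c.L), (by omega : c.L < 2 * c.L), c.V_zero] using this
    · rcases lt_trichotomy (u + 1) (2 * c.L) with hlt | heq | hgt'
      · have := c.edge_mem x' (u - c.L) (by omega)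
        rw [show u - c.L + 1 = u + 1 - c.L by omega] at this
        simp only [if_neg (by omega : ¬ u < c.L), if_neg (by omega : ¬ u + 1 < c.L), if_pos hlt,
          if_pos (by omega : u < 2 * c.L)]
        simpa using this
      · have := c.edge_mem x' (u - c.L) (by omega)
        rw [show u - c.L + 1 = c.L by omega, c.V_end] at this
        simp only [heq, if_neg (by omega : ¬ u < c.L), if_neg (by omega : ¬ 2 * c.L < c.L),
          if_pos (by omega : u < 2 * c.L), lt_irrefl, if_false, Nat.sub_self, c.V_zero]
        simpa using this
      · rw [if_neg (by omega), if_neg (by omega), if_neg (by omega), if_neg (by omega),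
          if_neg (by omega), if_neg (by omega)]
        have hb : ∀ b, (c.V b (u - 2 * c.L), c.B x' (u - 2 * c.L), c.V b (u + 1 - 2 * c.L)) ∈ E := by
          intro b
          rw [c.B_eq_of_lt x' b (by omega), show u + 1 - 2 * c.L = u - 2 * c.L + 1 by omega]
          exact c.edge_mem b _ (by omega)
        simp only [List.mem_cons, List.not_mem_nil, or_false, forall_eq_or_imp, forall_eq,
          exists_eq_or_imp, exists_eq_left]
        exact ⟨Or.inl (hb true), Or.inr (hb false)⟩
  · obtain rfl := h0 h₂
    rw [h₂]
    rw [if_neg (by omega : ¬ c.κ + 1 + t % c.L + φ < c.L),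
      if_neg (by omega : ¬ c.κ + 1 + t % c.L + φ < c.L)]
    rcases lt_trichotomy (c.κ + 1 + φ) c.L with hlt | heq | hgt
    · rw [if_pos (by omega), if_pos (by omega), if_pos (by omega)]
      have := c.edge_mem y' (c.κ + φ) (by omega)
      rw [show c.κ + 1 + t % c.L + φ - c.L = c.κ + φ by omega,
        show c.κ + 1 + 0 + φ = c.κ + φ + 1 by omega]
      simpa using this
    · rw [if_neg (by omega), if_pos (by omega), if_pos (by omega), if_pos (by omega)]
      have := c.edge_mem y' (c.κ + φ) (by omega)
      rw [show c.κ + φ + 1 = c.L by omega, c.V_end] at this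
      rw [show c.κ + 1 + t % c.L + φ - c.L = c.κ + φ by omega,
        show c.κ + 1 + 0 + φ - c.L = 0 by omega, c.V_zero]
      simpa using this
    · rw [if_neg (by omega), if_pos (by omega), if_neg (by omega), if_neg (by omega)]
      have := c.edge_mem x' (c.κ + φ - c.L) (by omega)
      rw [show c.κ + 1 + t % c.L + φ - 2 * c.L = c.κ + φ - c.L by omega,
        show c.κ + 1 + 0 + φ - c.L = c.κ + φ - c.L + 1 by omega,
        c.B_eq_of_lt y' x' (by omega)]
      cases x' <;> simp [this]

end Data

end TwoCycles

/-! ### Successive paths of fixed length -/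

section Paths

variable {E : GraphCode} {ℓ t : ℕ}

/-- Every path of positive length is followed by some path, which can be prescribed. -/
theorem exists_next_path
    (hE : ∀ q ∈ E, ∃ q' ∈ E, q'.1 = q.2.2) (hℓ : 0 < ℓ) (α β : PathOfLength E ℓ) :
    ∃ γ : PathOfLength E ℓ, Connects α.1 γ.1 ∧ (Connects α.1 β.1 → γ = β) := by
  by_cases hc : Connects α.1 β.1
  · exact ⟨β, hc, fun _ => rfl⟩
  -- When `β` does not connect, a continuation is made by iterating a successor function from the
  -- last edge of `α`.
  choose! f hfE hf using hE
  obtain ⟨α, ⟨hα, hα'⟩, hl⟩ := α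
  have hne : α.reverse ≠ [] := by
    rw [Ne, List.reverse_eq_nil_iff, ← List.length_eq_zero_iff]
    omega
  have hmem : α.reverse.headI ∈ E := by
    apply hα
    rw [← List.mem_reverse]
    obtain ⟨q, l, hql⟩ := List.exists_cons_of_ne_nil hne
    simp [hql]
  have hg : ∀ i, f^[i] α.reverse.headI ∈ E := by
    intro i
    induction i with
    | zero => exact hmem
    | succ i ih =>
      rw [Function.iterate_succ_apply']
      exact hfE _ ih
  have hgf : ∀ i, (f^[i] α.reverse.headI).2.2 = (f^[i + 1] α.reverse.headI).1 := by
    intro i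
    rw [Function.iterate_succ_apply', hf _ (hg i)]
  refine ⟨⟨pathSegment (fun i => f^[i] α.reverse.headI) 1 ℓ, ⟨?_, ?_⟩, length_pathSegment _ _ _⟩,
    ?_, fun h => absurd h hc⟩
  · intro q hq
    obtain ⟨j, -, rfl⟩ := List.mem_map.1 hq
    exact hg _
  · rw [List.isChain_iff_getElem]
    intro i hi
    simpa [pathSegment, add_assoc] using hgf (1 + i)
  · obtain ⟨m, rfl⟩ := Nat.exists_eq_succ_of_ne_zero hℓ.ne'
    change α.reverse.headI.2.2 = (pathSegment (fun i => f^[i] α.reverse.headI) 1 (m + 1)).headI.1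
    rw [pathSegment_succ]
    exact hgf 0

theorem PathOfLength.getD_mem (α : PathOfLength E ℓ)
    (ht : t < ℓ) : α.1.getD t default ∈ E := by
  rw [List.getD_eq_getElem _ _ (by rwa [α.2.2])]
  exact α.2.1.1 _ (List.getElem_mem _)

theorem PathOfLength.getD_succ (α : PathOfLength E ℓ)
    (ht : t + 1 < ℓ) : (α.1.getD t default).2.2 = (α.1.getD (t + 1) default).1 := by
  have h := α.2.2
  rw [List.getD_eq_getElem _ _ (by omega), List.getD_eq_getElem _ _ (by omega)]
  exact List.isChain_iff_getElem.1 α.2.1.2 t (by omega)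

theorem Connects.getD_eq {α γ : PathOfLength E ℓ}
    (h : Connects α.1 γ.1) (ht : t + 1 = ℓ) :
    (α.1.getD t default).2.2 = (γ.1.getD 0 default).1 := by
  obtain ⟨α, hα', hα⟩ := α
  obtain ⟨γ, hγ', hγ⟩ := γ
  obtain ⟨α, q, rfl⟩ := (List.eq_nil_or_concat' α).resolve_left (by rintro rfl; simp at hα; omega)
  cases γ with
  | nil => simp at hγ; omega
  | cons q' γ =>
    have hlen : α.length = t := by
      rw [List.length_append, List.length_singleton] at hα
      omega
    simpa [Connects, ← hlen] using h

end Paths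

namespace TwoCycles

variable {E : GraphCode} (c : TwoCycles E)

/-! ### Layout of a tile: marker, separator, data blocks, display cell -/

section Letters

/-- The encoding is one-hot, so it suffices to compare the bit at the index of `s`. -/
theorem bits_eq_of_forall_bit {s r : c.State} (h : ∀ k < c.bits, c.bit s k = c.bit r k) :
    s = r := by
  have := h _ (Finite.equivFin c.State s).2
  simp only [bit, decide_true, eq_comm (a := true), decide_eq_true_eq, Fin.val_inj,
    EmbeddingLike.apply_eq_iff_eq] at this
  exact this.symm

theorem run_pos : 0 < c.run := Nat.succ_pos _

theorem cell_cases {o : ℕ} (ho : o < c.tileLength) :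
    o < c.markerLength ∨ (∃ i ≤ 2 * c.period, o = c.markerLength + i) ∨
    (∃ k < c.bits, ∃ φ < c.L, o = c.markerLength + (2 * c.period + 1) + (k * c.L + φ)) ∨
    o = c.tileLength - 1 := by
  have hL := c.L_pos
  rcases Nat.lt_or_ge o c.markerLength with h₁ | h₁
  · exact Or.inl h₁
  rcases Nat.lt_or_ge o (c.markerLength + (2 * c.period + 1)) with h₂ | h₂
  · exact Or.inr (Or.inl ⟨o - c.markerLength, by omega, by omega⟩)
  rcases Nat.lt_or_ge (o + 1) c.tileLength with h₃ | h₃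
  · refine Or.inr (Or.inr (Or.inl ⟨(o - (c.markerLength + (2 * c.period + 1))) / c.L, ?_,
      (o - (c.markerLength + (2 * c.period + 1))) % c.L, Nat.mod_lt _ hL, ?_⟩))
    · rw [Nat.div_lt_iff_lt_mul hL]
      unfold tileLength tailLength at h₃
      omega
    · rw [Nat.div_add_mod']
      omega
  · exact Or.inr (Or.inr (Or.inr (by omega)))

variable (t : ℕ) (s s' : c.State)

theorem tileLetter_marker {o : ℕ} (ho : o < c.markerLength) :
    c.tileLetter t s s' o = c.mark (t + o / c.run) :=
  if_pos ho

theorem tileVertices_marker {o : ℕ} (ho : o < c.markerLength) :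
    c.tileVertices t s s' o = [c.markVertex (t + o / c.run)] :=
  if_pos ho

theorem tileLetter_separator {i : ℕ} (hi : i ≤ 2 * c.period) :
    c.tileLetter t s s' (c.markerLength + i) = c.mark (t + i) := by
  rw [tileLetter, if_neg (by omega), if_pos (by omega), Nat.add_sub_cancel_left]

theorem tileVertices_separator {i : ℕ} (hi : i ≤ 2 * c.period) :
    c.tileVertices t s s' (c.markerLength + i) = [c.markVertex (t + i)] := by
  rw [tileVertices, if_neg (by omega), if_pos (by omega), Nat.add_sub_cancel_left]

theorem data_lt {k φ : ℕ} (hk : k < c.bits) (hφ : φ < c.L) :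
    c.markerLength + (2 * c.period + 1) + (k * c.L + φ) + 1 < c.tileLength := by
  unfold tileLength tailLength
  have : (k + 1) * c.L ≤ c.bits * c.L := Nat.mul_le_mul_right _ hk
  rw [Nat.succ_mul] at this
  omega

theorem tileLetter_data {k φ : ℕ} (hk : k < c.bits) (hφ : φ < c.L) :
    c.tileLetter t s s' (c.markerLength + (2 * c.period + 1) + (k * c.L + φ)) =
      c.dataLetter (c.bit s k) (c.bit s' k) t φ := by
  have hL := c.L_pos
  rw [tileLetter, if_neg (by omega), if_neg (by omega), if_pos (c.data_lt hk hφ),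
    Nat.add_sub_cancel_left, add_comm (k * c.L), Nat.add_mul_div_right _ _ hL,
    Nat.add_mul_mod_self_right, Nat.div_eq_of_lt hφ, Nat.mod_eq_of_lt hφ, zero_add]

theorem tileVertices_data {k φ : ℕ} (hk : k < c.bits) (hφ : φ < c.L) :
    c.tileVertices t s s' (c.markerLength + (2 * c.period + 1) + (k * c.L + φ)) =
      c.dataVertices (c.bit s k) (c.bit s' k) t φ := by
  have hL := c.L_pos
  rw [tileVertices, if_neg (by omega), if_neg (by omega), if_pos (c.data_lt hk hφ),
    Nat.add_sub_cancel_left, add_comm (k * c.L), Nat.add_mul_div_right _ _ hL,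
    Nat.add_mul_mod_self_right, Nat.div_eq_of_lt hφ, Nat.mod_eq_of_lt hφ, zero_add]

theorem tileLetter_last :
    c.tileLetter t s s' (c.tileLength - 1) = (s.1.1.getD t default).2.1 := by
  have h : c.markerLength + (2 * c.period + 1) ≤ c.tileLength - 1 := by
    unfold tileLength tailLength
    omega
  rw [tileLetter, if_neg (by omega), if_neg (by omega), if_neg (by omega)]

theorem tileVertices_last :
    c.tileVertices t s s' (c.tileLength - 1) = [(s.1.1.getD t default).1] := by
  have h : c.markerLength + (2 * c.period + 1) ≤ c.tileLength - 1 := by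
    unfold tileLength tailLength
    omega
  rw [tileVertices, if_neg (by omega), if_neg (by omega), if_neg (by omega)]

@[simp]
theorem length_tile : (c.tile t s s').length = c.tileLength := by
  simp [tile]

theorem tile_getD {o : ℕ} (ho : o < c.tileLength) :
    (c.tile t s s').getD o 0 = c.tileLetter t s s' o := by
  rw [List.getD_eq_getElem _ _ (by simpa using ho)]
  simp [tile]

theorem tileLength_pos : 0 < c.tileLength := by
  unfold tileLength tailLength
  omega

theorem le_markerLength {h : ℕ} (hh : h < c.period + 2) : (h + 1) * c.run ≤ c.markerLength :=
  Nat.mul_le_mul_right _ hh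

end Letters

/-! ### Reading the time and the state from a tile -/

section Injectivity

variable {c} {t t' : ℕ} {s s' r r' : c.State}

theorem tileLetter_eq_of_tile_eq (h : c.tile t s s' = c.tile t' r r') {o : ℕ}
    (ho : o < c.tileLength) : c.tileLetter t s s' o = c.tileLetter t' r r' o := by
  rw [← c.tile_getD _ _ _ ho, h, c.tile_getD _ _ _ ho]

theorem tile_eq_of_tileLetter_eq
    (h : ∀ o < c.tileLength, c.tileLetter t s s' o = c.tileLetter t' r r' o) :
    c.tile t s s' = c.tile t' r r' :=
  List.map_congr_left fun o ho => h o (List.mem_range.1 ho)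

/-- The first letters of the runs spell a whole period of `mark` from `t`, and primitivity
identifies `t`. -/
theorem time_eq_of_tile_eq (ht : t < c.period) (ht' : t' < c.period)
    (h : c.tile t s s' = c.tile t' r r') : t = t' := by
  refine c.eq_of_forall_mark_eq ht ht' fun j hj => ?_
  have hlt : j * c.run < c.markerLength := by
    have := c.le_markerLength (h := j) (by omega)
    have := c.run_pos
    rw [Nat.succ_mul] at *
    omega
  have := tileLetter_eq_of_tile_eq h (o := j * c.run) (by unfold tileLength; omega)
  rwa [c.tileLetter_marker _ _ _ hlt, c.tileLetter_marker _ _ _ hlt,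
    Nat.mul_div_cancel _ c.run_pos] at this

/-- The letters at `κ` reveal the bits of the current state. The previous state need not be
recoverable. -/
theorem state_eq_of_tile_eq (h : c.tile t s s' = c.tile t r r') : s = r := by
  have hL := c.L_pos
  refine c.bits_eq_of_forall_bit fun k hk => ?_
  have hφ : c.L - 1 - t % c.L < c.L := by omega
  have hlt := c.data_lt hk hφ
  have := tileLetter_eq_of_tile_eq h
    (o := c.markerLength + (2 * c.period + 1) + (k * c.L + (c.L - 1 - t % c.L))) (by omega)
  rw [c.tileLetter_data _ _ _ hk hφ, c.tileLetter_data _ _ _ hk hφ, c.dataLetter_visible,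
    c.dataLetter_visible] at this
  by_contra hne
  have hB := c.B_ne
  cases h₁ : c.bit s k <;> cases h₂ : c.bit r k <;> simp_all

end Injectivity

/-! ### Tiles do not overlap -/

section Synchronization

/-- Two tiles at the same time form a word in which a tile occurs only at the beginning or at the
end. -/
theorem offset_eq_zero {t t' : ℕ} {s s' r r' u u' : c.State} {j : ℕ} (hj : j < c.tileLength)
    (h : ((c.tile t s s' ++ c.tile t r r').drop j).take c.tileLength = c.tile t' u u') :
    j = 0 := by
  by_contra hj0
  have hP : c.tileLength = c.markerLength + c.tailLength := rfl
  have hT : c.tailLength = 2 * c.period + 1 + c.bits * c.L + 1 := rfl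
  have hR : c.run = c.tailLength + 1 := rfl
  have hRpos := c.run_pos
  have hp := c.period_pos
  set y : ℕ → ℕ := fun o => (c.tile t s s' ++ c.tile t r r').getD o 0 with hy
  have hy₁ : ∀ o < c.tileLength, y o = c.tileLetter t s s' o := by
    intro o ho
    simp only [hy]
    rw [List.getD_append _ _ _ _ (by simpa using ho), c.tile_getD _ _ _ ho]
  have hy₂ : ∀ o < c.tileLength, y (c.tileLength + o) = c.tileLetter t r r' o := by
    intro o ho
    simp only [hy]
    rw [List.getD_append_right _ _ _ _ (by simp), c.length_tile, Nat.add_sub_cancel_left,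
      c.tile_getD _ _ _ ho]
  have hy₃ : ∀ o < c.tileLength, y (j + o) = c.tileLetter t' u u' o := by
    intro o ho
    rw [← c.tile_getD _ _ _ ho, ← h]
    simp only [hy, List.getD_eq_getElem?_getD]
    rw [List.getElem?_take_of_lt ho, List.getElem?_drop]
  -- Inside the marker of the supposed occurrence at `j`, letters change only at multiples of `run`,
  -- counted from `j`. Each case below finds a change elsewhere.
  have hchange : ∀ o, j ≤ o → o + 1 < j + c.markerLength → y o ≠ y (o + 1) →
      (o + 1 - j) % c.run = 0 := by
    intro o hjo ho hne
    by_contra hmod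
    apply hne
    obtain ⟨i, rfl⟩ := Nat.exists_eq_add_of_le hjo
    rw [add_assoc j i 1, hy₃ i (by omega), hy₃ (i + 1) (by omega),
      c.tileLetter_marker _ _ _ (by omega), c.tileLetter_marker _ _ _ (by omega)]
    rw [show j + i + 1 - j = i + 1 by omega] at hmod
    rw [Nat.succ_div_of_not_dvd fun hd => hmod (Nat.mod_eq_zero_of_dvd hd)]
  have hstep : ∀ h, h + 1 < c.period + 2 → (h + 1) * c.run - 1 < c.markerLength ∧
      (h + 1) * c.run < c.markerLength ∧ 0 < (h + 1) * c.run ∧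
      ((h + 1) * c.run - 1) / c.run = h ∧ (h + 1) * c.run / c.run = h + 1 := by
    intro h hh
    have h₁ := c.le_markerLength hh
    have h₂ : (h + 1) * c.run = h * c.run + c.run := Nat.succ_mul _ _
    have h₃ : (h + 1 + 1) * c.run = (h + 1) * c.run + c.run := Nat.succ_mul _ _
    refine ⟨by omega, by omega, by omega, ?_, Nat.mul_div_cancel _ hRpos⟩
    rw [show (h + 1) * c.run - 1 = c.run - 1 + h * c.run by omega,
      Nat.add_mul_div_right _ _ hRpos, Nat.div_eq_of_lt (by omega), zero_add]
  have hmod : ∀ a d : ℕ, 0 < d → d < c.run → d ≤ a * c.run → (a * c.run - d) % c.run ≠ 0 := by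
    intro a d hd hd' hle h0
    have h₁ : c.run ∣ a * c.run - d := Nat.dvd_of_mod_eq_zero h0
    have h₂ : c.run ∣ d := (Nat.dvd_sub_iff_right hle (Dvd.intro_left a rfl)).1 h₁
    exact absurd (Nat.le_of_dvd hd h₂) (by omega)
  obtain ⟨h, hh, hne⟩ := c.exists_mark_ne_succ (t + 1)
  -- For small `j`, the runs of the left marker are displaced by `j < run`.
  rcases Nat.lt_or_ge j (2 * c.period + 1) with hlt | hge
  · obtain ⟨h₁, h₂, h₃, h₄, h₅⟩ := hstep (h + 1) (by omega)
    have hle : c.run ≤ (h + 1) * c.run := Nat.le_mul_of_pos_left _ (Nat.succ_pos _)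
    have hle' : (h + 1 + 1) * c.run = (h + 1) * c.run + c.run := Nat.succ_mul _ _
    have := hchange ((h + 1 + 1) * c.run - 1) (by omega) (by omega) (by
      rw [Nat.sub_add_cancel h₃, hy₁ _ (by omega), hy₁ _ (by omega),
        c.tileLetter_marker _ _ _ h₁, c.tileLetter_marker _ _ _ h₂, h₄, h₅]
      rwa [show t + (h + 1) = t + 1 + h by ring, show t + (h + 1 + 1) = t + 1 + h + 1 by ring])
    rw [Nat.sub_add_cancel h₃] at this
    exact hmod _ j (by omega) (by omega) (by omega) this
  -- For large `j`, the runs of the right marker are displaced by `tileLength - j`, which is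
  -- positive and smaller than `run`.
  rcases Nat.lt_or_ge c.markerLength j with hgt | hle
  · obtain ⟨h₁, h₂, h₃, h₄, h₅⟩ := hstep (h + 1) (by omega)
    have hle : c.run ≤ (h + 1) * c.run := Nat.le_mul_of_pos_left _ (Nat.succ_pos _)
    have hle' : (h + 1 + 1) * c.run = (h + 1) * c.run + c.run := Nat.succ_mul _ _
    have hle'' := c.le_markerLength (h := h + 1 + 1) (by omega)
    rw [Nat.succ_mul (h + 1 + 1)] at hle''
    have := hchange (c.tileLength + ((h + 1 + 1) * c.run - 1)) (by omega) (by omega) (by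
      rw [add_assoc c.tileLength, Nat.sub_add_cancel h₃, hy₂ _ (by omega), hy₂ _ (by omega),
        c.tileLetter_marker _ _ _ h₁, c.tileLetter_marker _ _ _ h₂, h₄, h₅]
      rwa [show t + (h + 1) = t + 1 + h by ring, show t + (h + 1 + 1) = t + 1 + h + 1 by ring])
    rw [show c.tileLength + ((h + 1 + 1) * c.run - 1) + 1 - j =
      c.tileLength - j + (h + 1 + 1) * c.run by omega, Nat.add_mul_mod_self_right,
      Nat.mod_eq_of_lt (by omega)] at this
    omega
  -- In between, the left separator lies in the marker of the occurrence and contains two changes at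
  -- distance `period < run`. This is why it spans two periods.
  · obtain ⟨h, hh, hne⟩ := c.exists_mark_ne_succ t
    have hsep : ∀ i < 2 * c.period, c.mark (t + i) ≠ c.mark (t + i + 1) →
        (c.markerLength + i + 1 - j) % c.run = 0 := by
      intro i hi hne
      refine hchange _ (by omega) (by omega) ?_
      rw [add_assoc, hy₁ _ (by omega), hy₁ _ (by omega), c.tileLetter_separator _ _ _ (by omega),
        c.tileLetter_separator _ _ _ (by omega)]
      exact hne
    have h₁ := hsep h (by omega) hne
    have h₂ := hsep (h + c.period) (by omega) (by
      rwa [show t + (h + c.period) = t + h + c.period by ring, c.mark_add_period,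
        show t + h + c.period + 1 = t + h + 1 + c.period by ring, c.mark_add_period])
    rw [show c.markerLength + (h + c.period) + 1 - j =
      c.markerLength + h + 1 - j + c.period by omega, Nat.add_mod, h₁, zero_add, Nat.mod_mod,
      Nat.mod_eq_of_lt (by omega)] at h₂
    omega

end Synchronization

/-! ### Evolution of the tiles -/

section Dynamics

/-- The time of the following tile. -/
def nextTime (t : ℕ) : ℕ := if t + 1 = c.period then 0 else t + 1

theorem nextTime_lt {t : ℕ} (ht : t < c.period) : c.nextTime t < c.period := by
  unfold nextTime
  split_ifs <;> omega

theorem period_mod : c.period % c.L = 0 := by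
  rw [period, Nat.mul_mod_left]

theorem nextTime_mod (t : ℕ) : c.nextTime t % c.L = (t + 1) % c.L := by
  unfold nextTime
  split_ifs with h
  · rw [h, c.period_mod, Nat.zero_mod]
  · rfl

theorem mark_nextTime (t i : ℕ) : c.markVertex (c.nextTime t + i) = c.markVertex (t + i + 1) := by
  unfold nextTime
  split_ifs with h
  · rw [show t + i + 1 = 0 + i + c.period by omega, c.markVertex_add_period]
  · congr 1
    omega

variable (nx : PathOfLength E c.period → PathOfLength E c.period → PathOfLength E c.period)

/-- The state of the following tile, when `r` is the state of the tile to the right. -/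
def nextState (t : ℕ) (s r : c.State) : c.State :=
  if t + 1 = c.period then (nx s.1 s.2, r.2) else s

/-- The previous state of the following tile. -/
def nextPrev (t : ℕ) (s s' : c.State) : c.State := if (t + 1) % c.L = 0 then s else s'

variable {c nx}

theorem nextState_eq {t : ℕ} (h : (t + 1) % c.L ≠ 0) (s r : c.State) :
    c.nextState nx t s r = s :=
  if_neg fun h' => h (by rw [h', c.period_mod])

/-- The following tile does not depend on the previous states. -/
theorem tile_next_eq {t : ℕ} {s s' r' u : c.State} (h : c.tile t s s' = c.tile t s r')
    (hu : (t + 1) % c.L ≠ 0 → u = s) :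
    c.tile (c.nextTime t) u (c.nextPrev t s s') = c.tile (c.nextTime t) u (c.nextPrev t s r') := by
  have hL := c.L_pos
  refine tile_eq_of_tileLetter_eq fun o ho => ?_
  rcases c.cell_cases ho with h₁ | ⟨i, hi, rfl⟩ | ⟨k, hk, φ, hφ, rfl⟩ | rfl
  · rw [c.tileLetter_marker _ _ _ h₁, c.tileLetter_marker _ _ _ h₁]
  · rw [c.tileLetter_separator _ _ _ hi, c.tileLetter_separator _ _ _ hi]
  · rw [c.tileLetter_data _ _ _ hk hφ, c.tileLetter_data _ _ _ hk hφ]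
    rcases Nat.lt_or_ge (φ + 1) c.L with hlt | hge
    · have hd := tileLetter_eq_of_tile_eq h
        (o := c.markerLength + (2 * c.period + 1) + (k * c.L + (φ + 1)))
        (by have := c.data_lt hk hlt; omega)
      rw [c.tileLetter_data _ _ _ hk hlt, c.tileLetter_data _ _ _ hk hlt] at hd
      have key : ∀ v, c.dataLetter (c.bit u k) (c.bit (c.nextPrev t s v) k) (c.nextTime t) φ =
          c.dataLetter (c.bit s k) (c.bit v k) t (φ + 1) := fun v =>
        c.dataLetter_succ (c.nextTime_mod t)
          (fun h => ⟨by rw [hu h], by rw [nextPrev, if_neg h]⟩)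
          (fun h => by rw [nextPrev, if_pos h]) hlt
      rw [key, key, hd]
    · obtain rfl : φ = c.L - 1 := by omega
      exact c.dataLetter_last _ _ _ _
  · rw [c.tileLetter_last, c.tileLetter_last]

variable (c) in
theorem tileVertices_ne_nil (t : ℕ) (s s' : c.State) (o : ℕ) : c.tileVertices t s s' o ≠ [] := by
  unfold tileVertices
  split_ifs
  · simp
  · simp
  · exact c.dataVertices_ne_nil _ _ _ _
  · simp

/-- Marker and separator follow the path of `mark`, data blocks follow `dataVertices_succ`, and the
display cell follows the active path. At the end of the period the latter continues because `nx`
always returns a connecting path. -/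
theorem tileVertices_next (hnx : ∀ α β, Connects α.1 (nx α β).1) {t : ℕ} (ht : t < c.period)
    (s s' r : c.State) {o : ℕ} (ho : o < c.tileLength) :
    ∀ q' ∈ c.tileVertices (c.nextTime t) (c.nextState nx t s r) (c.nextPrev t s s') o,
      ∃ q ∈ c.tileVertices t s s' o, (q, c.tileLetter t s s' o, q') ∈ E := by
  rcases c.cell_cases ho with h₁ | ⟨i, hi, rfl⟩ | ⟨k, hk, φ, hφ, rfl⟩ | rfl
  · rw [c.tileVertices_marker _ _ _ h₁, c.tileVertices_marker _ _ _ h₁,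
      c.tileLetter_marker _ _ _ h₁, c.mark_nextTime]
    simpa using c.mark_edge_mem _
  · rw [c.tileVertices_separator _ _ _ hi, c.tileVertices_separator _ _ _ hi,
      c.tileLetter_separator _ _ _ hi, c.mark_nextTime]
    simpa using c.mark_edge_mem _
  · rw [c.tileVertices_data _ _ _ hk hφ, c.tileVertices_data _ _ _ hk hφ,
      c.tileLetter_data _ _ _ hk hφ]
    exact c.dataVertices_succ (c.nextTime_mod t)
      (fun h => ⟨by rw [nextState_eq h], by rw [nextPrev, if_neg h]⟩)
      (fun h => by rw [nextPrev, if_pos h]) hφ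
  · rw [c.tileVertices_last, c.tileVertices_last, c.tileLetter_last]
    have hmem := s.1.getD_mem ht
    simp only [List.mem_singleton, forall_eq, exists_eq_left]
    suffices h : (s.1.1.getD t default).2.2 =
        ((c.nextState nx t s r).1.1.getD (c.nextTime t) default).1 by
      rwa [← h]
    unfold nextState nextTime
    split_ifs with h
    · exact (hnx s.1 s.2).getD_eq h
    · exact s.1.getD_succ (by omega)

/-- Every letter of a tile labels an edge of `E`, as the compatible vertex sets show. -/
theorem tile_lt {n : ℕ} (hwf : E.WellFormed n) (hnx : ∀ α β, Connects α.1 (nx α β).1) {t : ℕ}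
    (ht : t < c.period) (s s' : c.State) : ∀ a ∈ c.tile t s s', a < n := by
  intro a ha
  obtain ⟨o, ho, rfl⟩ := List.mem_map.1 ha
  obtain ⟨q', hq'⟩ := List.exists_mem_of_ne_nil _ (c.tileVertices_ne_nil (c.nextTime t)
    (c.nextState nx t s s) (c.nextPrev t s s') o)
  obtain ⟨q, -, hq⟩ := tileVertices_next hnx ht s s' s (List.mem_range.1 ho) q' hq'
  exact hwf _ hq

end Dynamics

end TwoCycles

/-- The graph of an uncountable set of infinite words admits a tile system, a vertex labelling and a
supply of paths. -/
theorem exists_tileSystem {n : ℕ} {E : GraphCode} (hwf : E.WellFormed n)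
    (hE : ∀ q ∈ E, ∃ q' ∈ E, q'.1 = q.2.2) (hunc : ¬ E.labels.Countable) :
    ∃ P N Λ ℓ Q K, IsTileSystem n P N ∧ IsVertexLabelling P N E Λ ∧
      IsSupply E ℓ (P - 1) N Q K := by
  obtain ⟨c⟩ := nonempty_twoCycles hunc
  choose nx hnx hnx' using exists_next_path hE c.period_pos
  obtain ⟨N, hN⟩ := exists_list_of_finite (Set.finite_range
    fun x : Fin c.period × (c.State × c.State) × (c.State × c.State) =>
      (c.tile x.1 x.2.1.1 x.2.1.2, c.tile x.1 x.2.2.1 x.2.2.2,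
        c.tile (c.nextTime x.1) (c.nextState nx x.1 x.2.1.1 x.2.2.1)
          (c.nextPrev x.1 x.2.1.1 x.2.1.2)))
  obtain ⟨Λ, hΛ⟩ := exists_list_of_finite (Set.finite_range
    fun x : (Fin c.period × Fin c.tileLength) × c.State × c.State =>
      (c.tile x.1.1 x.2.1 x.2.2, (x.1.2 : ℕ), c.tileVertices x.1.1 x.2.1 x.2.2 x.1.2))
  obtain ⟨Q, hQ⟩ := exists_list_of_finite (finite_paths E c.period)
  obtain ⟨K, hK⟩ := exists_list_of_finite (Set.finite_range
    fun x : Fin c.period × c.State × c.State =>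
      ((x.1 : ℕ), c.tile x.1 x.2.1 x.2.2, x.2.1.1.1, x.2.1.2.1))
  refine ⟨c.tileLength, N, Λ, c.period, Q, K, ⟨c.tileLength_pos, ?_, ?_, ?_, ?_⟩, ?_,
    c.period_pos, ⟨?_, ?_⟩, ?_, ?_, ?_⟩
  · intro τ hτ
    obtain ⟨⟨t, ⟨s, s'⟩, ⟨r, r'⟩⟩, rfl⟩ := (hN _).1 hτ
    exact ⟨c.length_tile _ _ _, c.length_tile _ _ _, c.length_tile _ _ _,
      TwoCycles.tile_lt hwf hnx t.2 _ _, TwoCycles.tile_lt hwf hnx (c.nextTime_lt t.2) _ _⟩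
  · intro τ hτ τ' hτ' h
    obtain ⟨⟨t, ⟨s, s'⟩, ⟨r, r'⟩⟩, rfl⟩ := (hN _).1 hτ
    obtain ⟨⟨t₁, ⟨s₁, s₁'⟩, ⟨r₁, r₁'⟩⟩, rfl⟩ := (hN _).1 hτ'
    obtain rfl : t = t₁ := Fin.ext (TwoCycles.time_eq_of_tile_eq t.2 t₁.2 h)
    exact ⟨_, (hN _).2 ⟨⟨⟨_, c.nextTime_lt t.2⟩, ⟨_, _⟩, ⟨_, _⟩⟩, rfl⟩, rfl, rfl⟩
  · intro τ hτ τ' hτ' h h'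
    obtain ⟨⟨t, ⟨s, s'⟩, ⟨r, r'⟩⟩, rfl⟩ := (hN _).1 hτ
    obtain ⟨⟨t₁, ⟨s₁, s₁'⟩, ⟨r₁, r₁'⟩⟩, rfl⟩ := (hN _).1 hτ'
    obtain rfl : t = t₁ := Fin.ext (TwoCycles.time_eq_of_tile_eq t.2 t₁.2 h)
    obtain rfl : s = s₁ := TwoCycles.state_eq_of_tile_eq h
    obtain rfl : r = r₁ := TwoCycles.state_eq_of_tile_eq h'
    exact TwoCycles.tile_next_eq h fun h => TwoCycles.nextState_eq h _ _
  · intro τ hτ τ' hτ' j hj h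
    obtain ⟨⟨t, ⟨s, s'⟩, ⟨r, r'⟩⟩, rfl⟩ := (hN _).1 hτ
    obtain ⟨⟨t₁, ⟨s₁, s₁'⟩, ⟨r₁, r₁'⟩⟩, rfl⟩ := (hN _).1 hτ'
    exact c.offset_eq_zero hj h
  · intro τ hτ i hi
    obtain ⟨⟨t, ⟨s, s'⟩, ⟨r, r'⟩⟩, rfl⟩ := (hN _).1 hτ
    refine ⟨⟨_, (hΛ _).2 ⟨⟨⟨t, ⟨i, hi⟩⟩, s, s'⟩, rfl⟩, rfl, rfl⟩, fun x hx h h' => ?_⟩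
    obtain ⟨⟨⟨t₁, i₁⟩, s₁, s₁'⟩, rfl⟩ := (hΛ _).1 hx
    obtain rfl : t₁ = t := Fin.ext (TwoCycles.time_eq_of_tile_eq t₁.2 t.2 h)
    obtain rfl : s₁ = s := TwoCycles.state_eq_of_tile_eq h
    obtain rfl : (i₁ : ℕ) = i := h'
    refine ⟨c.tileVertices_ne_nil _ _ _ _, _, (hΛ _).2 ⟨⟨⟨⟨_, c.nextTime_lt t₁.2⟩, i₁⟩,
      c.nextState nx t₁ s₁ r, c.nextPrev t₁ s₁ s₁'⟩, rfl⟩,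
      -- One tile may come from different previous states and carry a vertex set for each of them.
      -- The successor set is taken for the previous state of `x`, while the rule was built with
      -- that of `τ`; the next tiles agree.
      TwoCycles.tile_next_eq h fun h => TwoCycles.nextState_eq h _ _, rfl, ?_⟩
    dsimp only
    rw [← show c.tile t₁ s₁ s₁' = c.tile t₁ s₁ s' from h, c.tile_getD _ _ _ hi]
    exact TwoCycles.tileVertices_next hnx t₁.2 _ _ _ hi
  · exact (hQ _).2 ⟨⟨by simp, List.isChain_nil⟩, by simp⟩
  · intro β hβ hlt q hq h
    obtain ⟨⟨hβE, hchain⟩, hl⟩ := (hQ _).1 hβ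
    refine (hQ _).2 ⟨⟨by simpa [hq] using hβE, ?_⟩, by simpa using hlt⟩
    cases β with
    | nil => simp
    | cons q' β => exact List.isChain_cons_cons.2 ⟨by simpa using h, hchain⟩
  · intro α hα β hβ hl hl'
    -- Any previous state would do at time `0`; the current state is used.
    exact ⟨_, (hK _).2 ⟨⟨⟨0, c.period_pos⟩, (⟨α, ((hQ _).1 hα).1, hl⟩, ⟨β, ((hQ _).1 hβ).1, hl'⟩),
      (⟨α, ((hQ _).1 hα).1, hl⟩, ⟨β, ((hQ _).1 hβ).1, hl'⟩)⟩, rfl⟩, rfl, rfl⟩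
  · intro x hx y hy h
    obtain ⟨⟨t, s, s'⟩, rfl⟩ := (hK _).1 hx
    obtain ⟨⟨t₁, r, r'⟩, rfl⟩ := (hK _).1 hy
    obtain rfl : t = t₁ := Fin.ext h
    refine ⟨_, (hN _).2 ⟨⟨t, ⟨s, s'⟩, ⟨r, r'⟩⟩, rfl⟩, rfl, rfl, ?_⟩
    have ht := t.2
    rcases Nat.lt_or_ge ((t : ℕ) + 1) c.period with hlt | hge
    · refine Or.inl ⟨hlt, (hK _).2 ⟨⟨⟨t + 1, hlt⟩, s, c.nextPrev t s s'⟩, ?_⟩⟩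
      simp [TwoCycles.nextTime, TwoCycles.nextState, hlt.ne]
    · have heq : (t : ℕ) + 1 = c.period := by omega
      refine Or.inr ⟨heq, _, (hK _).2 ⟨⟨⟨0, c.period_pos⟩, c.nextState nx t s r,
        c.nextPrev t s s'⟩, rfl⟩, rfl, ?_, ?_, fun hc => ?_⟩
      · simp [TwoCycles.nextTime, heq]
      · simp [TwoCycles.nextState, heq]
      · simpa [TwoCycles.nextState, heq] using congrArg Subtype.val (hnx' _ _ hc)
  · intro x hx
    obtain ⟨⟨t, s, s'⟩, rfl⟩ := (hK _).1 hx
    dsimp only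
    rw [c.tile_getD _ _ _ (by have := c.tileLength_pos; omega), c.tileLetter_last]

/-! ### Correctness of the algorithm -/

section Correctness

variable {A : Type*} [TopologicalSpace A] {n : ℕ} {e : A ≃ Fin n}
  {S : Subshift A ℕ} {D : SoficCode}

/-- The vertex labelling controls all cells and gives one inclusion; the supply uses only the
display cell `P - 1` and gives the other. -/
theorem traceOn_tileCA_eq {P : ℕ} {N : TileRules} {E : GraphCode}
    {Λ : List (Word × ℕ × List ℕ)} {ℓ : ℕ} {Q : List (List (ℕ × ℕ × ℕ))}
    {K : List (ℕ × Word × List (ℕ × ℕ × ℕ) × List (ℕ × ℕ × ℕ))}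
    (hn : 0 < n) (hN : IsTileSystem n P N) (hwf : E.WellFormed n)
    (hE : ∀ q ∈ E, ∃ q' ∈ E, q'.1 = q.2.2) (hΛ : IsVertexLabelling P N E Λ)
    (hK : IsSupply E ℓ (P - 1) N Q K) (hS : S.carrier = {x | coded e x ∈ E.labels}) :
    (tileCA e hN hn).traceOn {x | ∃ r : ℤ, ∀ k : ℤ, PairAt P N (coded e x) (r + k * P)} =
      S.carrier := by
  have hP := hN.1
  ext z
  rw [mem_traceOn_tileCA_iff]
  constructor
  · rintro ⟨T, hT, i, hi, hz⟩
    refine mem_of_forall_prefix fun m => ?_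
    obtain ⟨z', hz', hzz'⟩ := hΛ.exists_mem_labels hE hT hi m
    have hlt : ∀ s, z' s < n := by
      obtain ⟨v, hv⟩ := hz'
      exact fun s => hwf _ (hv s)
    refine ⟨uncoded e z' hlt, ?_, fun s hs => ?_⟩
    · rw [hS, Set.mem_ofPred_eq, coded_uncoded]
      exact hz'
    · apply e.injective
      apply Fin.ext
      rw [← hz s, ← hzz' s hs]
      simp [uncoded]
  · intro hz
    rw [hS] at hz
    obtain ⟨T, hT, hTz⟩ := hK.exists_evolution hz
    exact ⟨T, hT, P - 1, by omega, hTz⟩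

theorem Certifies.exists_partiallyTraces [DiscreteTopology A] (hD : D.Represents e S) {c : Certificate}
    (hc : Certifies n D c) :
    ∃ (F : CellularAutomaton A) (Γ : Subshift A ℤ), PartiallyTraces F Γ S ∧
      CACode.Represents e (tileCACode n c.1.1 c.1.2) F ∧
      IsGraphOf e (tileGraph c.1.1 c.1.2) Γ.carrier := by
  obtain ⟨hn, hN, hnf, hΛ, hK⟩ := hc
  have : Finite A := Finite.of_equiv _ e.symm
  obtain ⟨Γ, hΓ, hΓc⟩ := exists_isSFT_tileSystem e hN
  refine ⟨tileCA e hN hn, Γ, ⟨hΓ, ?_, ?_⟩, tileCACode_represents e hN hn, ?_⟩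
  · rw [hΓc]
    rintro x ⟨r, hr⟩
    exact ⟨r, forall_pairAt_globalMap e hN hn hr⟩
  · rw [hΓc]
    exact traceOn_tileCA_eq hn hN (hnf.wellFormed hD) (fun q hq => (hnf.2.2.2.1 q hq).2.2) hΛ hK
      (hnf.carrier_eq hD)
  · rw [hΓc]
    exact isGraphOf_tileGraph e hN

theorem exists_certifies (hS : ¬ S.carrier.Countable) (hD : D.Represents e S) :
    ∃ c, Certifies n D c := by
  obtain ⟨R, C, Z, E, hnf⟩ := exists_isNormalForm D
  have hcar := hnf.carrier_eq hD
  have hunc : ¬ E.labels.Countable := by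
    intro h
    apply hS
    rw [hcar]
    exact h.preimage_of_injOn (coded_injective e).injOn
  have hn : 0 < n := by
    rcases S.carrier.eq_empty_or_nonempty with h | ⟨x, -⟩
    · rw [h] at hS
      exact absurd Set.countable_empty hS
    · exact (Nat.zero_le _).trans_lt (e (x 0)).2
  obtain ⟨P, N, Λ, ℓ, Q, K, hN, hΛ, hK⟩ :=
    exists_tileSystem (hnf.wellFormed hD) (fun q hq => (hnf.2.2.2.1 q hq).2.2) hunc
  exact ⟨((P, N), (R, C, Z, E), Λ, ℓ, Q, K), hn, hN, hnf, hΛ, hK⟩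

theorem searchAlgorithm_spec [DiscreteTopology A] (hS : ¬ S.carrier.Countable) (hD : D.Represents e S) :
    ∃ out ∈ searchAlgorithm (n, D), ∃ (F : CellularAutomaton A) (Γ : Subshift A ℤ),
      PartiallyTraces F Γ S ∧ CACode.Represents e out.1 F ∧ IsGraphOf e out.2 Γ.carrier := by
  obtain ⟨c, hc⟩ := exists_certifies hS hD
  obtain ⟨c', hc', hmem⟩ := exists_mem_searchAlgorithm hc
  exact ⟨_, hmem, hc'.exists_partiallyTraces hD⟩

end Correctness

end SoficTrace

theorem mainTheorem6 :
    ∃ algo : ℕ × SoficTrace.SoficCode →. SoficTrace.CACode × SoficTrace.GraphCode,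
      Partrec algo ∧
      ∀ (A : Type*) [Finite A] [TopologicalSpace A] [DiscreteTopology A]
        (S : SymbolicDynamics.FullShift.Subshift A ℕ),
        SoficTrace.IsSofic S → ¬ S.carrier.Countable →
          SoficTrace.IsPartiallyTraceable S ∧
          ∀ (n : ℕ) (e : A ≃ Fin n) (D : SoficTrace.SoficCode), D.Represents e S →
            ∃ out ∈ algo (n, D),
              ∃ (F : SoficTrace.CellularAutomaton A)
                (Γ : SymbolicDynamics.FullShift.Subshift A ℤ),
                SoficTrace.PartiallyTraces F Γ S ∧
                SoficTrace.CACode.Represents e out.1 F ∧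
                SoficTrace.IsGraphOf e out.2 Γ.carrier := by
  refine ⟨SoficTrace.searchAlgorithm, SoficTrace.partrec_searchAlgorithm, ?_⟩
  intro A _ _ _ S hsofic hunc
  refine ⟨?_, fun n e D hD => SoficTrace.searchAlgorithm_spec hunc hD⟩
  obtain ⟨n, ⟨e⟩⟩ := Finite.exists_equiv_fin A
  -- Regularity of the language serves only to produce some representation; traceability then
  -- follows from the output of the algorithm on it.
  obtain ⟨D, hD⟩ := SoficTrace.exists_represents_of_isSofic e hsofic
  obtain ⟨_, _, F, Γ, h, -⟩ := SoficTrace.searchAlgorithm_spec hunc hD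
  exact ⟨F, Γ, h⟩
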